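/- Let $k$ be a commutative ring (associative, with $1$) and let $(H,\Delta,\epsilon,\phi)$ be a quasi-bialgebra over $k$: $H$ is a unital $k$-algebra, $\Delta:H\to H\otimes H$ and $\epsilon:H\to k$ are algebra homomorphisms, and $\phi\in H\otimes H\otimes H$ is invertible, with $$(\epsilon\otimes\mathrm{id})\Delta=\mathrm{id}=(\mathrm{id}\otimes\epsilon)\Delta,\qquad (\mathrm{id}\otimes\Delta)\Delta(h)\cdot\phi=\phi\cdot(\Delta\otimes\mathrm{id})\Delta(h),$$ $$(\mathrm{id}\otimes\mathrm{id}\otimes\Delta)(\phi)\,(\Delta\otimes\mathrm{id}\otimes\mathrm{id})(\phi)=(1\otimes\phi)\,(\mathrm{id}\otimes\Delta\otimes\mathrm{id})(\phi)\,(\phi\otimes1),\qquad (\mathrm{id}\otimes\epsilon\otimes\mathrm{id})(\phi)=1\otimes1 .$$ Write $\Delta(h)=h_{(1)}\otimes h_{(2)}$, $\phi=\phi^{(1)}\otimes\phi^{(2)}\otimes\phi^{(3)}$ and $\phi^{-1}=\phi^{(-1)}\otimes\phi^{(-2)}\otimes\phi^{(-3)}$ (sums suppressed). Let $H$ be a quasi-Hopf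 algebra: there are given an algebra anti-automorphism $S$ of $H$ and elements $\alpha,\beta\in H$ with $$S(h_{(1)})\,\alpha\,h_{(2)}=\epsilon(h)\alpha,\quad h_{(1)}\,\beta\,S(h_{(2)})=\epsilon(h)\beta,\quad \phi^{(1)}\beta S(\phi^{(2)})\alpha\phi^{(3)}=1,\quad S(\phi^{(-1)})\alpha\phi^{(-2)}\beta S(\phi^{(-3)})=1 .$$ Let $H$ moreover be quasitriangular: there is given an invertible $R=R^{(1)}\otimes R^{(2)}\in H\otimes H$ with $\Delta^{\mathrm{op}}(h)=R\,\Delta(h)\,R^{-1}$, $$(\mathrm{id}\otimes\Delta)(R)=\phi_{231}^{-1}R_{13}\,\phi_{213}\,R_{12}\,\phi^{-1},\qquad(\Delta\otimes\mathrm{id})(R)=\phi_{312}\,R_{13}\,\phi_{132}^{-1}\,R_{23}\,\phi ,$$ where $\phi_{ijl}$ (resp. $R_{ij}$) has its first, second, third component in the tensor slots $i,j,l$ (resp. first and second component in the slots $i,j$), and $1$ in any remaining slot. Let ${}^H\mathscr M$ be the category of left $H$-modules. It is monoidal: $V\otimes W$ is the tensor product over $k$ with $H$ acting through $\Delta$,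 the unit object is $k$ with $H$ acting through $\epsilon$, and the associator is $\Phi:(V\otimes W)\otimes X\to V\otimes(W\otimes X)$, $(v\otimes w)\otimes x\mapsto\phi^{(1)}v\otimes(\phi^{(2)}w\otimes\phi^{(3)}x)$. It is braided by $\tau_{V,W}(v\otimes w)=R^{(2)}w\otimes R^{(1)}v$. It has internal homs $\mathrm{hom}(V,W)=\mathrm{Hom}_k(V,W)$, with $h\rhd L=h_{(1)}\circ L\circ S(h_{(2)})$, evaluation $\mathrm{ev}(L\otimes v)=\phi^{(1)}L(S(\phi^{(2)})\alpha\phi^{(3)}v)$, and currying bijections $\zeta:\mathrm{Hom}(X\otimes V,W)\to\mathrm{Hom}(X,\mathrm{hom}(V,W))$, $\zeta(f)(x)(v)=f(\phi^{(-1)}x\otimes\phi^{(-2)}\beta S(\phi^{(-3)})v)$. Let $A$ be a braided commutative algebra in ${}^H\mathscr M$, that is, a monoid object with multiplication $\mu$ such that $\mu\circ\tau_{A,A}=\mu$. A symmetric $A$-bimodule in ${}^H\mathscr M$ is an $A$-bimodule object $V$ whose left action $l:A\otimes V\to V$ and right action $r:V\otimes A\to V$ satisfy $r\circ\tau_{A,V}=l$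 and $l\circ\tau_{V,A}=r$. Symmetric $A$-bimodules and bimodule morphisms form a category ${}^H{}_A\mathscr M{}_A^{\mathrm{sym}}$, with the following structure induced from ${}^H\mathscr M$. * $V\otimes_AW$ is the coequalizer of $r\otimes\mathrm{id}$ and $(\mathrm{id}\otimes l)\circ\Phi:(V\otimes A)\otimes W\to V\otimes W$; the associator $\Phi^A$ and the braiding $\tau^A_{V,W}:V\otimes_AW\to W\otimes_AV$ are induced by $\Phi$ and $\tau$; the unit object is $A$. * $\mathrm{hom}_A(V,W)$ is the equalizer of the two morphisms $\mathrm{hom}(V,W)\to\mathrm{hom}(V\otimes A,W)$ obtained by currying $\mathrm{ev}\circ(\mathrm{id}\otimes r)$ and $r\circ(\mathrm{ev}\otimes\mathrm{id})\circ\Phi^{-1}$, respectively. Its left and right $A$-actions are the restrictions of the morphisms $A\otimes\mathrm{hom}(V,W)\to\mathrm{hom}(V,W)$ and $\mathrm{hom}(V,W)\otimes A\to\mathrm{hom}(V,W)$ given by composing with $\zeta(l)$, that is, of $\bullet\circ(\zeta(l_W)\otimes\mathrm{id})$ and $\bullet\circ(\mathrm{id}\otimes\zeta(l_V))$, where $\bullet=\zeta\big(\mathrm{ev}\circ(\mathrm{id}\otimes\mathrm{ev})\circ\Phi\big)$.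 The evaluation $\mathrm{ev}^A:\mathrm{hom}_A(V,W)\otimes_AV\to W$ is induced by $\mathrm{ev}$, and $\zeta^A:\mathrm{Hom}(X\otimes_AV,W)\to\mathrm{Hom}(X,\mathrm{hom}_A(V,W))$ is the corresponding currying bijection, so $\mathrm{ev}^A\circ(\zeta^A(f)\otimes_A\mathrm{id})=f$. For morphisms $f:X\to V$, $g:W\to Y$, let $g\circ(\,\cdot\,)\circ f:\mathrm{hom}_A(V,W)\to\mathrm{hom}_A(X,Y)$ be the functorial action of $\mathrm{hom}_A$, that is $\zeta^A\big(g\circ\mathrm{ev}^A\circ(\mathrm{id}\otimes_Af)\big)$, which sends a map $L$ to $g\circ L\circ f$. * The composition morphisms $\bullet^A_{V,W,X}:\mathrm{hom}_A(W,X)\otimes_A\mathrm{hom}_A(V,W)\to\mathrm{hom}_A(V,X)$ are $\bullet^A_{V,W,X}=\zeta^A\big(\mathrm{ev}^A\circ(\mathrm{id}\otimes_A\mathrm{ev}^A)\circ\Phi^A\big)$. * The tensor product morphisms ${\otimes\!\!\!\!\bullet}^{\,A}_{V,W,X,Y}:\mathrm{hom}_A(V,W)\otimes_A\mathrm{hom}_A(X,Y)\to\mathrm{hom}_A(V\otimes_AX,W\otimes_AY)$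 are $${\otimes\!\!\!\!\bullet}^{\,A}_{V,W,X,Y}=\zeta^A\Big((\mathrm{ev}^A\otimes_A\mathrm{ev}^A)\circ(\Phi^A)^{-1}\circ(\mathrm{id}\otimes_A\Phi^A)\circ\big(\mathrm{id}\otimes_A(\tau^A_{\mathrm{hom}_A(X,Y),V}\otimes_A\mathrm{id})\big)\circ\big(\mathrm{id}\otimes_A(\Phi^A)^{-1}\big)\circ\Phi^A\Big),$$ where the composite in the outer parentheses is a morphism $(\mathrm{hom}_A(V,W)\otimes_A\mathrm{hom}_A(X,Y))\otimes_A(V\otimes_AX)\to W\otimes_AY$. Then for any six symmetric $A$-bimodules $U,V,W,X,Y,Z$ in ${}^H\mathscr M$ the following hold. (i) (Braided composition property.) As morphisms from $\big(\mathrm{hom}_A(V,Y)\otimes_A\mathrm{hom}_A(X,Z)\big)\otimes_A\big(\mathrm{hom}_A(U,V)\otimes_A\mathrm{hom}_A(W,X)\big)$ to $\mathrm{hom}_A(U\otimes_AW,Y\otimes_AZ)$, $$\bullet^A_{U\otimes_AW,\,V\otimes_AX,\,Y\otimes_AZ}\circ\big({\otimes\!\!\!\!\bullet}^{\,A}_{V,Y,X,Z}\otimes_A{\otimes\!\!\!\!\bullet}^{\,A}_{U,V,W,X}\big)={\otimes\!\!\!\!\bullet}^{\,A}_{U,Y,W,Z}\circ\big(\bullet^A_{U,V,Y}\otimes_A\bullet^A_{W,X,Z}\big)\circ\Theta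 ,$$ where $\Theta$ is the rebracketing and flip of the middle factors $$\Theta=(\Phi^A)^{-1}\circ(\mathrm{id}\otimes_A\Phi^A)\circ\big(\mathrm{id}\otimes_A(\tau^A_{\mathrm{hom}_A(X,Z),\mathrm{hom}_A(U,V)}\otimes_A\mathrm{id})\big)\circ\big(\mathrm{id}\otimes_A(\Phi^A)^{-1}\big)\circ\Phi^A .$$ (ii) (Weak associativity.) As morphisms from $\big(\mathrm{hom}_A(U,V)\otimes_A\mathrm{hom}_A(W,X)\big)\otimes_A\mathrm{hom}_A(Y,Z)$ to $\mathrm{hom}_A\big(U\otimes_A(W\otimes_AY),V\otimes_A(X\otimes_AZ)\big)$, $$\big(\Phi^A_{V,X,Z}\circ(\,\cdot\,)\circ(\Phi^A_{U,W,Y})^{-1}\big)\circ{\otimes\!\!\!\!\bullet}^{\,A}_{U\otimes_AW,\,V\otimes_AX,\,Y,\,Z}\circ\big({\otimes\!\!\!\!\bullet}^{\,A}_{U,V,W,X}\otimes_A\mathrm{id}\big)={\otimes\!\!\!\!\bullet}^{\,A}_{U,V,\,W\otimes_AY,\,X\otimes_AZ}\circ\big(\mathrm{id}\otimes_A{\otimes\!\!\!\!\bullet}^{\,A}_{W,X,Y,Z}\big)\circ\Phi^A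 .$$ -/

import Mathlib

open CategoryTheory MonoidalCategory BraidedCategory Limits

universe v₁ u₁

/-- Internal homs for `(–) ⊗ V` in a monoidal category: an object `ihom V W`, an evaluation
`ev : ihom V W ⊗ V ⟶ W` and the currying bijection `ζ = curry : Hom(X ⊗ V, W) → Hom(X, ihom V W)`
whose inverse is `g ↦ ev ∘ (g ⊗ id)`. All of this is data, and the two laws say that `curry` and
`g ↦ ev ∘ (g ⊗ id)` are mutually inverse. -/
class RightInternalHom (C : Type u₁) [Category.{v₁} C] [MonoidalCategory C] where
  ihom : C → C → C
  ev (V W : C) : ihom V W ⊗ V ⟶ W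
  curry {X V W : C} (f : X ⊗ V ⟶ W) : X ⟶ ihom V W
  curry_ev {X V W : C} (f : X ⊗ V ⟶ W) : curry f ▷ V ≫ ev V W = f
  curry_unique {X V W : C} (f : X ⊗ V ⟶ W) (g : X ⟶ ihom V W) (h : g ▷ V ≫ ev V W = f) :
    g = curry f

namespace RightInternalHom

variable {C : Type u₁} [Category.{v₁} C] [MonoidalCategory C] [RightInternalHom C]

theorem ihom_ext {X V W : C} {f g : X ⟶ ihom V W} (h : f ▷ V ≫ ev V W = g ▷ V ≫ ev V W) :
    f = g :=
  (curry_unique _ f h).trans (curry_unique _ g rfl).symm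

/-- The composition morphism `• = ζ(ev ∘ (id ⊗ ev) ∘ Φ)`. -/
def comp (V W X : C) : ihom W X ⊗ ihom V W ⟶ ihom V X :=
  curry ((α_ (ihom W X) (ihom V W) V).hom ≫ ihom W X ◁ ev V W ≫ ev W X)

/-- The functorial action of the internal hom, `L ↦ g ∘ L ∘ f`: contravariant in the first and
covariant in the second argument. -/
def map {V W X Y : C} (f : X ⟶ V) (g : W ⟶ Y) : ihom V W ⟶ ihom X Y :=
  curry (ihom V W ◁ f ≫ ev V W ≫ g)

/-- The tensor product morphism
`⊗• = ζ((ev ⊗ ev) ∘ Φ⁻¹ ∘ (id ⊗ Φ) ∘ (id ⊗ (τ ⊗ id)) ∘ (id ⊗ Φ⁻¹) ∘ Φ)` of internal homs. -/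
def tens [BraidedCategory C] (V W X Y : C) : ihom V W ⊗ ihom X Y ⟶ ihom (V ⊗ X) (W ⊗ Y) :=
  curry ((α_ (ihom V W) (ihom X Y) (V ⊗ X)).hom ≫
    ihom V W ◁ (α_ (ihom X Y) V X).inv ≫
    ihom V W ◁ ((β_ (ihom X Y) V).hom ▷ X) ≫
    ihom V W ◁ (α_ V (ihom X Y) X).hom ≫
    (α_ (ihom V W) V (ihom X Y ⊗ X)).inv ≫
    (ev V W ⊗ₘ ev X Y))

end RightInternalHom

namespace Bimod

variable {C : Type u₁} [Category.{v₁} C] [MonoidalCategory C] [HasCoequalizers C]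
  [∀ X : C, PreservesColimitsOfSize.{0, 0} (tensorLeft X)]
  [∀ X : C, PreservesColimitsOfSize.{0, 0} (tensorRight X)]
  {A : Mon C}

/-- The monoidal category of bimodules over a monoid object `A`. The tensor product `M ⊗_A N` is
the coequalizer of the two maps `(M ⊗ A) ⊗ N ⟶ M ⊗ N`; the associator and unitors are the ones
induced from the ambient category. -/
noncomputable instance : MonoidalCategory (Bimod A A) where
  tensorObj M N := tensorBimod M N
  whiskerLeft M _ _ f := whiskerLeft M f
  whiskerRight f N := whiskerRight f N
  tensorUnit := regular A
  associator M N P := associatorBimod M N P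
  leftUnitor M := leftUnitorBimod M
  rightUnitor M := rightUnitorBimod M
  tensorHom_def _ _ := rfl
  whiskerLeft_id _ _ := whiskerLeft_id_bimod
  id_whiskerRight _ _ := id_whiskerRight_bimod
  id_tensorHom_id M N := by
    rw [whiskerLeft_id_bimod, id_whiskerRight_bimod, Category.comp_id]
  tensorHom_comp_tensorHom {X₁ Y₁ Z₁ X₂ Y₂ Z₂} f₁ f₂ g₁ g₂ := by
    rw [comp_whiskerRight_bimod, whiskerLeft_comp_bimod]
    simp only [Category.assoc]
    rw [← Category.assoc (whiskerLeft Y₁ f₂), whisker_exchange_bimod]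
    simp only [Category.assoc]
  associator_naturality {X₁ X₂ X₃ Y₁ Y₂ Y₃} f₁ f₂ f₃ := by
    rw [whiskerLeft_comp_bimod, comp_whiskerRight_bimod, comp_whiskerLeft_bimod,
      whiskerRight_comp_bimod, whisker_assoc_bimod]
    simp
  leftUnitor_naturality f := by
    rw [id_whiskerLeft_bimod]; simp
  rightUnitor_naturality f := by
    rw [whiskerRight_id_bimod]; simp
  pentagon M N P Q := pentagon_bimod M N P Q
  triangle M N := triangle_bimod M N

/-- The quotient map `M ⊗ N ⟶ M ⊗_A N`. -/
noncomputable def proj (M N : Bimod A A) : M.X ⊗ N.X ⟶ (M ⊗ N).X :=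
  coequalizer.π (M.actRight ▷ N.X) ((α_ M.X A.X N.X).hom ≫ M.X ◁ N.actLeft)

theorem proj_condition (M N : Bimod A A) :
    M.actRight ▷ N.X ≫ proj M N = (α_ M.X A.X N.X).hom ≫ M.X ◁ N.actLeft ≫ proj M N := by
  rw [← Category.assoc]
  exact coequalizer.condition _ _

/-- The map out of `M ⊗_A N` induced by an `A`-balanced map out of `M ⊗ N`. -/
noncomputable def projDesc {M N : Bimod A A} {Z : C} (f : M.X ⊗ N.X ⟶ Z)
    (h : M.actRight ▷ N.X ≫ f = (α_ M.X A.X N.X).hom ≫ M.X ◁ N.actLeft ≫ f) :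
    (M ⊗ N).X ⟶ Z :=
  coequalizer.desc f (by rw [h, Category.assoc])

theorem proj_desc {M N : Bimod A A} {Z : C} (f : M.X ⊗ N.X ⟶ Z)
    (h : M.actRight ▷ N.X ≫ f = (α_ M.X A.X N.X).hom ≫ M.X ◁ N.actLeft ≫ f) :
    proj M N ≫ projDesc f h = f :=
  coequalizer.π_desc _ _

instance (M N : Bimod A A) : Epi (proj M N) :=
  inferInstanceAs (Epi (coequalizer.π _ _))

instance epi_whiskerLeft {X Y : C} (Z : C) (f : X ⟶ Y) [Epi f] : Epi (Z ◁ f) :=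
  inferInstanceAs (Epi ((tensorLeft Z).map f))

instance epi_whiskerRight {X Y : C} (Z : C) (f : X ⟶ Y) [Epi f] : Epi (f ▷ Z) :=
  inferInstanceAs (Epi ((tensorRight Z).map f))

theorem proj_actLeft (M N : Bimod A A) :
    A.X ◁ proj M N ≫ (M ⊗ N).actLeft = (α_ A.X M.X N.X).inv ≫ M.actLeft ▷ N.X ≫ proj M N :=
  TensorBimod.whiskerLeft_π_actLeft M N

theorem proj_actRight (M N : Bimod A A) :
    proj M N ▷ A.X ≫ (M ⊗ N).actRight = (α_ M.X N.X A.X).hom ≫ M.X ◁ N.actRight ≫ proj M N :=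
  TensorBimod.π_tensor_id_actRight M N

theorem proj_whiskerLeft (M : Bimod A A) {N N' : Bimod A A} (f : N ⟶ N') :
    proj M N ≫ (M ◁ f).hom = M.X ◁ f.hom ≫ proj M N' := by
  change coequalizer.π _ _ ≫ colimMap _ = _
  rw [ι_colimMap]; rfl

theorem proj_whiskerRight {M M' : Bimod A A} (f : M ⟶ M') (N : Bimod A A) :
    proj M N ≫ (f ▷ N).hom = f.hom ▷ N.X ≫ proj M' N := by
  change coequalizer.π _ _ ≫ colimMap _ = _
  rw [ι_colimMap]; rfl

theorem proj_associator_hom (M N P : Bimod A A) :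
    proj M N ▷ P.X ≫ proj (M ⊗ N) P ≫ (α_ M N P).hom.hom =
      (α_ M.X N.X P.X).hom ≫ M.X ◁ proj N P ≫ proj M (N ⊗ P) := by
  have h1 : proj (M ⊗ N) P ≫ (α_ M N P).hom.hom = AssociatorBimod.homAux M N P :=
    coequalizer.π_desc _ _
  rw [h1]
  exact π_tensor_id_preserves_coequalizer_inv_desc _ _ _ _

theorem proj_associator_inv (M N P : Bimod A A) :
    M.X ◁ proj N P ≫ proj M (N ⊗ P) ≫ (α_ M N P).inv.hom =
      (α_ M.X N.X P.X).inv ≫ proj M N ▷ P.X ≫ proj (M ⊗ N) P := by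
  rw [Iso.eq_inv_comp]
  have := proj_associator_hom M N P
  rw [← Category.assoc, ← Category.assoc, Category.assoc _ _ (proj M (N ⊗ P)), ← this]
  simp only [Category.assoc]
  rw [← comp_hom', Iso.hom_inv_id, id_hom', Category.comp_id]



theorem projHom_actLeft {M N : Bimod A A} {P : Bimod A A} (f : (M ⊗ N).X ⟶ P.X)
    (h : M.actLeft ▷ N.X ≫ proj M N ≫ f =
      (α_ A.X M.X N.X).hom ≫ A.X ◁ (proj M N ≫ f) ≫ P.actLeft) :
    (M ⊗ N).actLeft ≫ f = A.X ◁ f ≫ P.actLeft := by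
  rw [← cancel_epi (A.X ◁ proj M N), ← Category.assoc, proj_actLeft]
  simp only [Category.assoc]
  rw [h]
  simp

theorem projHom_actRight {M N : Bimod A A} {P : Bimod A A} (f : (M ⊗ N).X ⟶ P.X)
    (h : M.X ◁ N.actRight ≫ proj M N ≫ f =
      (α_ M.X N.X A.X).inv ≫ (proj M N ≫ f) ▷ A.X ≫ P.actRight) :
    (M ⊗ N).actRight ≫ f = f ▷ A.X ≫ P.actRight := by
  rw [← cancel_epi (proj M N ▷ A.X), ← Category.assoc, proj_actRight]
  simp only [Category.assoc]
  rw [h]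
  simp

section Symm

variable [BraidedCategory C]

theorem halfSymm_tensor (V W : Bimod A A)
    (hV : (β_ A.X V.X).hom ≫ V.actRight = V.actLeft)
    (hW : (β_ A.X W.X).hom ≫ W.actRight = W.actLeft) :
    (β_ A.X (V ⊗ W).X).hom ≫ (V ⊗ W).actRight = (V ⊗ W).actLeft := by
  rw [← cancel_epi (A.X ◁ proj V W), ← Category.assoc, braiding_naturality_right, Category.assoc,
    proj_actRight, proj_actLeft, braiding_tensor_right_hom]
  simp only [Category.assoc, Iso.inv_hom_id_assoc]
  rw [← whiskerLeft_comp_assoc, hW, ← proj_condition, ← comp_whiskerRight_assoc, hV]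

theorem projBraiding_condition (V W : Bimod A A)
    (hV : (β_ V.X A.X).hom ≫ V.actLeft = V.actRight)
    (hW : (β_ A.X W.X).hom ≫ W.actRight = W.actLeft) :
    V.actRight ▷ W.X ≫ (β_ V.X W.X).hom ≫ proj W V =
      (α_ V.X A.X W.X).hom ≫ V.X ◁ W.actLeft ≫ (β_ V.X W.X).hom ≫ proj W V := by
  rw [braiding_naturality_left_assoc, braiding_naturality_right_assoc, ← hV, ← hW]
  rw [whiskerLeft_comp, comp_whiskerRight]
  simp only [Category.assoc]
  rw [proj_condition, braiding_tensor_left_hom, braiding_tensor_right_hom]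
  simp only [Category.assoc, Iso.hom_inv_id_assoc]
  have h := (yang_baxter V.X A.X W.X) =≫ (W.X ◁ V.actLeft ≫ proj W V)
  simp only [Category.assoc] at h
  rw [← h]
  simp

/-- The braiding descends to `V ⊗_A W ⟶ W ⊗_A V`. -/
noncomputable def braidHom (V W : Bimod A A)
    (hV : (β_ V.X A.X).hom ≫ V.actLeft = V.actRight)
    (hW : (β_ A.X W.X).hom ≫ W.actRight = W.actLeft) : (V ⊗ W).X ⟶ (W ⊗ V).X :=
  projDesc ((β_ V.X W.X).hom ≫ proj W V) (projBraiding_condition V W hV hW)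

theorem proj_braidHom (V W : Bimod A A)
    (hV : (β_ V.X A.X).hom ≫ V.actLeft = V.actRight)
    (hW : (β_ A.X W.X).hom ≫ W.actRight = W.actLeft) :
    proj V W ≫ braidHom V W hV hW = (β_ V.X W.X).hom ≫ proj W V :=
  proj_desc _ _

theorem braidHom_actLeft (V W : Bimod A A)
    (hV : (β_ V.X A.X).hom ≫ V.actLeft = V.actRight)
    (hW : (β_ A.X W.X).hom ≫ W.actRight = W.actLeft) :
    (V ⊗ W).actLeft ≫ braidHom V W hV hW = A.X ◁ braidHom V W hV hW ≫ (W ⊗ V).actLeft := by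
  apply projHom_actLeft
  rw [proj_braidHom, braiding_naturality_left_assoc, braiding_tensor_left_hom]
  simp only [Category.assoc, whiskerLeft_comp]
  rw [proj_actLeft, ← hW, comp_whiskerRight, Category.assoc, proj_condition]

theorem braidHom_actRight (V W : Bimod A A)
    (hV : (β_ V.X A.X).hom ≫ V.actLeft = V.actRight)
    (hW : (β_ A.X W.X).hom ≫ W.actRight = W.actLeft) :
    (V ⊗ W).actRight ≫ braidHom V W hV hW = braidHom V W hV hW ▷ A.X ≫ (W ⊗ V).actRight := by
  apply projHom_actRight
  rw [proj_braidHom, braiding_naturality_right_assoc, braiding_tensor_right_hom]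
  simp only [Category.assoc, comp_whiskerRight]
  rw [proj_actRight, ← hV, whiskerLeft_comp, Category.assoc, proj_condition]
  simp

/-- Symmetric bimodules: `r ∘ τ_{A,V} = l` and `l ∘ τ_{V,A} = r`, for the left action `l` and the
right action `r` of `A` on `V`. -/
def IsSymm (A : Mon C) : ObjectProperty (Bimod A A) := fun V =>
  (β_ A.X V.X).hom ≫ V.actRight = V.actLeft ∧ (β_ V.X A.X).hom ≫ V.actLeft = V.actRight

instance isMonoidal_isSymm [IsCommMonObj A.X] : (IsSymm A).IsMonoidal where
  prop_unit := ⟨IsCommMonObj.mul_comm A.X, IsCommMonObj.mul_comm A.X⟩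
  prop_tensor V W hV hW := by
    refine ⟨halfSymm_tensor V W hV.1 hW.1, ?_⟩
    have h := @halfSymm_tensor C _ _ _ _ _ A (reverseBraiding C) V W
      ((Iso.inv_comp_eq _).2 hV.2.symm) ((Iso.inv_comp_eq _).2 hW.2.symm)
    exact ((Iso.inv_comp_eq _).1 h).symm

end Symm
end Bimod

open Bimod

section

variable {C : Type u₁} [Category.{v₁} C] [MonoidalCategory C] [BraidedCategory C]
  [HasCoequalizers C]
  [∀ X : C, PreservesColimitsOfSize.{0, 0} (tensorLeft X)]
  [∀ X : C, PreservesColimitsOfSize.{0, 0} (tensorRight X)]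

/-- The full subcategory of symmetric `A`-bimodules. -/
abbrev SymmBimod (A : Mon C) : Type _ := (Bimod.IsSymm A).FullSubcategory

namespace SymmBimod

variable {A : Mon C} [IsCommMonObj A.X]

/-- The isomorphism of bimodules induced by `τ` on `V ⊗_A W`. -/
noncomputable def braidingBimod (V W : SymmBimod A) : V.obj ⊗ W.obj ≅ W.obj ⊗ V.obj :=
  isoOfIso
    { hom := braidHom V.obj W.obj V.property.2 W.property.1
      inv := @braidHom C _ _ _ _ _ A (reverseBraiding C) W.obj V.obj
        ((Iso.inv_comp_eq _).2 W.property.1.symm) ((Iso.inv_comp_eq _).2 V.property.2.symm)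
      hom_inv_id := by
        rw [← cancel_epi (proj V.obj W.obj)]
        have h := @proj_braidHom C _ _ _ _ _ A (reverseBraiding C) W.obj V.obj
          ((Iso.inv_comp_eq _).2 W.property.1.symm) ((Iso.inv_comp_eq _).2 V.property.2.symm)
        rw [← Category.assoc, proj_braidHom, Category.assoc, h]
        exact (Iso.hom_inv_id_assoc _ _).trans (Category.comp_id _).symm
      inv_hom_id := by
        rw [← cancel_epi (proj W.obj V.obj)]
        have h := @proj_braidHom C _ _ _ _ _ A (reverseBraiding C) W.obj V.obj
          ((Iso.inv_comp_eq _).2 W.property.1.symm) ((Iso.inv_comp_eq _).2 V.property.2.symm)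
        rw [← Category.assoc, h, Category.assoc, proj_braidHom]
        exact (Iso.inv_hom_id_assoc _ _).trans (Category.comp_id _).symm }
    (braidHom_actLeft _ _ V.property.2 W.property.1)
    (braidHom_actRight _ _ V.property.2 W.property.1)

/-- The braiding `τ^A : V ⊗_A W ≅ W ⊗_A V` of symmetric bimodules, induced by `τ`. -/
noncomputable def braiding (V W : SymmBimod A) : V ⊗ W ≅ W ⊗ V :=
  (IsSymm A).isoMk (braidingBimod V W)

theorem proj_braiding (V W : SymmBimod A) :
    proj V.obj W.obj ≫ (braidingBimod V W).hom.hom = (β_ V.obj.X W.obj.X).hom ≫ proj W.obj V.obj :=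
  proj_braidHom _ _ V.property.2 W.property.1

noncomputable instance : BraidedCategory (SymmBimod A) where
  braiding := braiding
  braiding_naturality_right X {Y Z} f := by
    ext
    rw [← cancel_epi (proj _ _)]
    change proj X.obj Y.obj ≫ (X.obj ◁ f.hom).hom ≫ (braidingBimod X Z).hom.hom =
      proj X.obj Y.obj ≫ (braidingBimod X Y).hom.hom ≫ (f.hom ▷ X.obj).hom
    rw [reassoc_of% proj_whiskerLeft, proj_braiding, reassoc_of% (proj_braiding X Y),
      proj_whiskerRight, braiding_naturality_right_assoc]
  braiding_naturality_left {X Y} f Z := by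
    ext
    rw [← cancel_epi (proj _ _)]
    change proj X.obj Z.obj ≫ (f.hom ▷ Z.obj).hom ≫ (braidingBimod Y Z).hom.hom =
      proj X.obj Z.obj ≫ (braidingBimod X Z).hom.hom ≫ (Z.obj ◁ f.hom).hom
    rw [reassoc_of% proj_whiskerRight, proj_braiding, reassoc_of% (proj_braiding X Z),
      proj_whiskerLeft, braiding_naturality_left_assoc]
  hexagon_forward X Y Z := by
    ext
    rw [← cancel_epi (proj _ _), ← cancel_epi (proj _ _ ▷ _)]
    change proj X.obj Y.obj ▷ Z.obj.X ≫ proj (X.obj ⊗ Y.obj) Z.obj ≫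
        (α_ X.obj Y.obj Z.obj).hom.hom ≫ (braidingBimod X (Y ⊗ Z)).hom.hom ≫
          (α_ Y.obj Z.obj X.obj).hom.hom =
      proj X.obj Y.obj ▷ Z.obj.X ≫ proj (X.obj ⊗ Y.obj) Z.obj ≫
        ((braidingBimod X Y).hom ▷ Z.obj).hom ≫ (α_ Y.obj X.obj Z.obj).hom.hom ≫
          (Y.obj ◁ (braidingBimod X Z).hom).hom
    have h1 : proj X.obj (Y.obj ⊗ Z.obj) ≫ (braidingBimod X (Y ⊗ Z)).hom.hom =
        (β_ X.obj.X (Y.obj ⊗ Z.obj).X).hom ≫ proj (Y.obj ⊗ Z.obj) X.obj :=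
      proj_braiding X (Y ⊗ Z)
    rw [reassoc_of% proj_associator_hom, reassoc_of% h1, braiding_naturality_right_assoc,
      proj_associator_hom, reassoc_of% proj_whiskerRight, ← comp_whiskerRight_assoc,
      proj_braiding, comp_whiskerRight_assoc, reassoc_of% proj_associator_hom, proj_whiskerLeft,
      ← whiskerLeft_comp_assoc, proj_braiding, whiskerLeft_comp_assoc]
    have h := hexagon_forward X.obj.X Y.obj.X Z.obj.X =≫
      (Y.obj.X ◁ proj Z.obj X.obj ≫ proj Y.obj (Z.obj ⊗ X.obj))
    simpa only [Category.assoc] using h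
  hexagon_reverse X Y Z := by
    ext
    rw [← cancel_epi (proj _ _), ← cancel_epi (_ ◁ proj _ _)]
    change X.obj.X ◁ proj Y.obj Z.obj ≫ proj X.obj (Y.obj ⊗ Z.obj) ≫
        (α_ X.obj Y.obj Z.obj).inv.hom ≫ (braidingBimod (X ⊗ Y) Z).hom.hom ≫
          (α_ Z.obj X.obj Y.obj).inv.hom =
      X.obj.X ◁ proj Y.obj Z.obj ≫ proj X.obj (Y.obj ⊗ Z.obj) ≫
        (X.obj ◁ (braidingBimod Y Z).hom).hom ≫ (α_ X.obj Z.obj Y.obj).inv.hom ≫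
          ((braidingBimod X Z).hom ▷ Y.obj).hom
    have h1 : proj (X.obj ⊗ Y.obj) Z.obj ≫ (braidingBimod (X ⊗ Y) Z).hom.hom =
        (β_ (X.obj ⊗ Y.obj).X Z.obj.X).hom ≫ proj Z.obj (X.obj ⊗ Y.obj) :=
      proj_braiding (X ⊗ Y) Z
    rw [reassoc_of% proj_associator_inv, reassoc_of% h1, braiding_naturality_left_assoc,
      proj_associator_inv, reassoc_of% proj_whiskerLeft, ← whiskerLeft_comp_assoc,
      proj_braiding, whiskerLeft_comp_assoc, reassoc_of% proj_associator_inv, proj_whiskerRight,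
      ← comp_whiskerRight_assoc, proj_braiding, comp_whiskerRight_assoc]
    have h := hexagon_reverse X.obj.X Y.obj.X Z.obj.X =≫
      (proj Z.obj X.obj ▷ Y.obj.X ≫ proj (Z.obj ⊗ X.obj) Y.obj)
    simpa only [Category.assoc] using h

end SymmBimod
end


open RightInternalHom

namespace Bimod

variable {C : Type u₁} [Category.{v₁} C] [MonoidalCategory C] [RightInternalHom C]
  {A : Mon C}

/-- `ζ(l)`, for the left action `l` of `A` on `V`. -/
def lhat (V : Bimod A A) : A.X ⟶ ihom V.X V.X := curry V.actLeft

/-- The left action `• ∘ (ζ(l) ⊗ id)` of `A` on the internal hom. -/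
def ihomActLeft (V W : Bimod A A) : A.X ⊗ ihom V.X W.X ⟶ ihom V.X W.X :=
  lhat W ▷ ihom V.X W.X ≫ RightInternalHom.comp V.X W.X W.X

/-- The right action `• ∘ (id ⊗ ζ(l))` of `A` on the internal hom. -/
def ihomActRight (V W : Bimod A A) : ihom V.X W.X ⊗ A.X ⟶ ihom V.X W.X :=
  ihom V.X W.X ◁ lhat V ≫ RightInternalHom.comp V.X V.X W.X

/-- The curried form of `ev ∘ (id ⊗ r)`. -/
def evR (V W : Bimod A A) : ihom V.X W.X ⟶ ihom (V.X ⊗ A.X) W.X :=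
  curry (ihom V.X W.X ◁ V.actRight ≫ ev V.X W.X)

/-- The curried form of `r ∘ (ev ⊗ id) ∘ Φ⁻¹`. -/
def rEv (V W : Bimod A A) : ihom V.X W.X ⟶ ihom (V.X ⊗ A.X) W.X :=
  curry ((α_ (ihom V.X W.X) V.X A.X).inv ≫ ev V.X W.X ▷ A.X ≫ W.actRight)

theorem rightLinear_iff (V W : Bimod A A) {X : C} (f : X ⟶ ihom V.X W.X) :
    f ≫ evR V W = f ≫ rEv V W ↔ X ◁ V.actRight ≫ f ▷ V.X ≫ ev V.X W.X =
      (α_ X V.X A.X).inv ≫ (f ▷ V.X ≫ ev V.X W.X) ▷ A.X ≫ W.actRight := by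
  have h1 : (f ≫ evR V W) ▷ (V.X ⊗ A.X) ≫ ev _ _ =
      X ◁ V.actRight ≫ f ▷ V.X ≫ ev V.X W.X := by
    rw [evR, comp_whiskerRight, Category.assoc, curry_ev, whisker_exchange_assoc]
  have h2 : (f ≫ rEv V W) ▷ (V.X ⊗ A.X) ≫ ev _ _ =
      (α_ X V.X A.X).inv ≫ (f ▷ V.X ≫ ev V.X W.X) ▷ A.X ≫ W.actRight := by
    rw [rEv, comp_whiskerRight, Category.assoc, curry_ev]
    simp
  rw [← h1, ← h2]
  exact ⟨fun h => by rw [h], ihom_ext⟩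

variable [HasEqualizers C]

/-- The object underlying `hom_A(V, W)`: the equalizer of `evR` and `rEv`, that is, the part of
the internal hom that consists of right `A`-linear maps. -/
noncomputable def homAObj (V W : Bimod A A) : C := equalizer (evR V W) (rEv V W)

/-- The inclusion of `hom_A(V, W)` into the internal hom. -/
noncomputable def homAIncl (V W : Bimod A A) : homAObj V W ⟶ ihom V.X W.X :=
  equalizer.ι (evR V W) (rEv V W)

/-- The evaluation restricted to `hom_A(V, W) ⊗ V`. -/
noncomputable def evA (V W : Bimod A A) : homAObj V W ⊗ V.X ⟶ W.X :=
  homAIncl V W ▷ V.X ≫ ev V.X W.X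

theorem evA_ext {V W : Bimod A A} {X : C} {f g : X ⟶ homAObj V W}
    (h : f ▷ V.X ≫ evA V W = g ▷ V.X ≫ evA V W) : f = g := by
  apply equalizer.hom_ext
  apply ihom_ext
  rw [evA, ← comp_whiskerRight_assoc, ← comp_whiskerRight_assoc] at h
  exact h

theorem evA_rightLinear (V W : Bimod A A) :
    homAObj V W ◁ V.actRight ≫ evA V W =
      (α_ (homAObj V W) V.X A.X).inv ≫ evA V W ▷ A.X ≫ W.actRight :=
  (rightLinear_iff V W (homAIncl V W)).1 (equalizer.condition _ _)

/-- The factorization through `hom_A(V, W)` of a right `A`-linear map. -/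
noncomputable def homALift {V W : Bimod A A} {X : C} (f : X ⟶ ihom V.X W.X)
    (h : X ◁ V.actRight ≫ f ▷ V.X ≫ ev V.X W.X =
      (α_ X V.X A.X).inv ≫ (f ▷ V.X ≫ ev V.X W.X) ▷ A.X ≫ W.actRight) : X ⟶ homAObj V W :=
  equalizer.lift f ((rightLinear_iff V W f).2 h)

theorem homALift_incl {V W : Bimod A A} {X : C} (f : X ⟶ ihom V.X W.X)
    (h : X ◁ V.actRight ≫ f ▷ V.X ≫ ev V.X W.X =
      (α_ X V.X A.X).inv ≫ (f ▷ V.X ≫ ev V.X W.X) ▷ A.X ≫ W.actRight) :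
    homALift f h ≫ homAIncl V W = f :=
  equalizer.lift_ι _ _

theorem homALift_evA {V W : Bimod A A} {X : C} (f : X ⟶ ihom V.X W.X)
    (h : X ◁ V.actRight ≫ f ▷ V.X ≫ ev V.X W.X =
      (α_ X V.X A.X).inv ≫ (f ▷ V.X ≫ ev V.X W.X) ▷ A.X ≫ W.actRight) :
    homALift f h ▷ V.X ≫ evA V W = f ▷ V.X ≫ ev V.X W.X := by
  rw [evA, ← comp_whiskerRight_assoc, homALift_incl]

theorem ihomActLeft_ev (V W : Bimod A A) :
    (A.X ◁ homAIncl V W ≫ ihomActLeft V W) ▷ V.X ≫ ev V.X W.X =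
      (α_ A.X (homAObj V W) V.X).hom ≫ A.X ◁ evA V W ≫ W.actLeft := by
  rw [ihomActLeft, comp_whiskerRight, comp_whiskerRight, Category.assoc, Category.assoc,
    RightInternalHom.comp,
    curry_ev, associator_naturality_left_assoc, ← whisker_exchange_assoc, lhat, curry_ev, evA]
  simp

theorem ihomActRight_ev (V W : Bimod A A) :
    (homAIncl V W ▷ A.X ≫ ihomActRight V W) ▷ V.X ≫ ev V.X W.X =
      (α_ (homAObj V W) A.X V.X).hom ≫ homAObj V W ◁ V.actLeft ≫ evA V W := by
  rw [ihomActRight, comp_whiskerRight, comp_whiskerRight, Category.assoc, Category.assoc,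
    RightInternalHom.comp,
    curry_ev, associator_naturality_middle_assoc, ← whiskerLeft_comp_assoc, lhat, curry_ev, evA]
  simp [whisker_exchange_assoc]

/-- The restriction of the left action to `hom_A(V, W)`. -/
noncomputable def homAActLeft (V W : Bimod A A) : A.X ⊗ homAObj V W ⟶ homAObj V W :=
  homALift (A.X ◁ homAIncl V W ≫ ihomActLeft V W) (by
    have h := congrArg (fun t => A.X ◁ t) (evA_rightLinear V W)
    simp only [whiskerLeft_comp] at h
    rw [ihomActLeft_ev, associator_naturality_right_assoc, reassoc_of% h]
    simp only [comp_whiskerRight, Category.assoc]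
    rw [W.middle_assoc]
    simp)

/-- The restriction of the right action to `hom_A(V, W)`. -/
noncomputable def homAActRight (V W : Bimod A A) : homAObj V W ⊗ A.X ⟶ homAObj V W :=
  homALift (homAIncl V W ▷ A.X ≫ ihomActRight V W) (by
    have h : A.X ◁ V.actRight ≫ V.actLeft =
        (α_ A.X V.X A.X).inv ≫ V.actLeft ▷ A.X ≫ V.actRight := by
      rw [V.middle_assoc, Iso.inv_hom_id_assoc]
    rw [ihomActRight_ev, associator_naturality_right_assoc, ← whiskerLeft_comp_assoc, h]
    simp only [whiskerLeft_comp, Category.assoc]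
    rw [evA_rightLinear]
    simp)

theorem homAActLeft_evA (V W : Bimod A A) :
    homAActLeft V W ▷ V.X ≫ evA V W =
      (α_ A.X (homAObj V W) V.X).hom ≫ A.X ◁ evA V W ≫ W.actLeft := by
  rw [homAActLeft, homALift_evA, ihomActLeft_ev]

theorem homAActRight_evA (V W : Bimod A A) :
    homAActRight V W ▷ V.X ≫ evA V W =
      (α_ (homAObj V W) A.X V.X).hom ≫ homAObj V W ◁ V.actLeft ≫ evA V W := by
  rw [homAActRight, homALift_evA, ihomActRight_ev]

/-- The internal hom `hom_A(V, W)` of bimodules. -/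
noncomputable abbrev homA (V W : Bimod A A) : Bimod A A where
  X := homAObj V W
  actLeft := homAActLeft V W
  actRight := homAActRight V W
  one_actLeft := by
    apply evA_ext
    rw [comp_whiskerRight, Category.assoc, homAActLeft_evA]
    rw [associator_naturality_left_assoc, ← whisker_exchange_assoc, W.one_actLeft]
    simp
  actRight_one := by
    apply evA_ext
    rw [comp_whiskerRight, Category.assoc, homAActRight_evA]
    rw [associator_naturality_middle_assoc, ← whiskerLeft_comp_assoc, V.one_actLeft]
    simp
  left_assoc := by
    apply evA_ext
    rw [comp_whiskerRight, Category.assoc, homAActLeft_evA,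
      associator_naturality_left_assoc, ← whisker_exchange_assoc, W.left_assoc]
    simp only [comp_whiskerRight, Category.assoc]
    rw [homAActLeft_evA, associator_naturality_middle_assoc, ← whiskerLeft_comp_assoc,
      homAActLeft_evA]
    simp
  right_assoc := by
    apply evA_ext
    rw [comp_whiskerRight, Category.assoc, homAActRight_evA,
      associator_naturality_middle_assoc, ← whiskerLeft_comp_assoc, V.left_assoc]
    simp only [comp_whiskerRight, Category.assoc]
    rw [homAActRight_evA, associator_naturality_left_assoc, ← whisker_exchange_assoc,
      homAActRight_evA]
    simp
  middle_assoc := by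
    apply evA_ext
    simp only [comp_whiskerRight, Category.assoc]
    rw [homAActRight_evA, homAActLeft_evA, associator_naturality_left_assoc,
      ← whisker_exchange_assoc, homAActLeft_evA, associator_naturality_middle_assoc,
      ← whiskerLeft_comp_assoc, homAActRight_evA]
    simp

theorem halfSymm_homA [BraidedCategory C] (V W : Bimod A A)
    (hV : (β_ A.X V.X).hom ≫ V.actRight = V.actLeft)
    (hW : (β_ A.X W.X).hom ≫ W.actRight = W.actLeft) :
    (β_ A.X (homA V W).X).hom ≫ (homA V W).actRight = (homA V W).actLeft := by
  change (β_ A.X (homAObj V W)).hom ≫ homAActRight V W = homAActLeft V W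
  apply evA_ext
  rw [comp_whiskerRight, Category.assoc, homAActRight_evA, homAActLeft_evA, ← hV, ← hW,
    whiskerLeft_comp_assoc, evA_rightLinear, braiding_naturality_right_assoc,
    braiding_tensor_right_hom]
  simp

end Bimod


namespace Bimod

variable {C : Type u₁} [Category.{v₁} C] [MonoidalCategory C] [HasCoequalizers C]
  [∀ X : C, PreservesColimitsOfSize.{0, 0} (tensorLeft X)]
  [∀ X : C, PreservesColimitsOfSize.{0, 0} (tensorRight X)] {A : Mon C}

theorem proj_hom_actLeft {X V W : Bimod A A} (f : X ⊗ V ⟶ W) :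
    X.actLeft ▷ V.X ≫ proj X V ≫ f.hom =
      (α_ A.X X.X V.X).hom ≫ A.X ◁ (proj X V ≫ f.hom) ≫ W.actLeft := by
  rw [whiskerLeft_comp, Category.assoc, ← f.left_act_hom, reassoc_of% proj_actLeft]
  simp

theorem proj_hom_actRight {X V W : Bimod A A} (f : X ⊗ V ⟶ W) :
    X.X ◁ V.actRight ≫ proj X V ≫ f.hom =
      (α_ X.X V.X A.X).inv ≫ (proj X V ≫ f.hom) ▷ A.X ≫ W.actRight := by
  rw [comp_whiskerRight, Category.assoc, ← f.right_act_hom, reassoc_of% proj_actRight]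
  simp

variable [RightInternalHom C] [HasEqualizers C]

/-- The evaluation `ev^A : hom_A(V, W) ⊗_A V ⟶ W`, induced by `ev` on the quotient. -/
noncomputable def evABimod (V W : Bimod A A) : homA V W ⊗ V ⟶ W where
  hom := projDesc (M := homA V W) (evA V W) (homAActRight_evA V W)
  left_act_hom := by
    apply projHom_actLeft
    rw [proj_desc]
    exact homAActLeft_evA V W
  right_act_hom := by
    apply projHom_actRight
    rw [proj_desc]
    exact evA_rightLinear V W

theorem proj_evABimod (V W : Bimod A A) : proj (homA V W) V ≫ (evABimod V W).hom = evA V W :=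
  proj_desc (M := homA V W) _ (homAActRight_evA V W)

/-- The map underlying `ζ^A(f)`: the curried form of `f ∘ (X ⊗ V ⟶ X ⊗_A V)`. -/
noncomputable def curryAHom {X V W : Bimod A A} (f : X ⊗ V ⟶ W) : X.X ⟶ homAObj V W :=
  homALift (curry (proj X V ≫ f.hom)) (by
    rw [curry_ev]
    exact proj_hom_actRight f)

theorem curryAHom_evA {X V W : Bimod A A} (f : X ⊗ V ⟶ W) :
    curryAHom f ▷ V.X ≫ evA V W = proj X V ≫ f.hom := by
  rw [curryAHom, homALift_evA, curry_ev]

/-- The currying map `ζ^A`. -/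
noncomputable def curryA {X V W : Bimod A A} (f : X ⊗ V ⟶ W) : X ⟶ homA V W where
  hom := curryAHom f
  left_act_hom := by
    apply evA_ext
    change _ = (A.X ◁ curryAHom f ≫ homAActLeft V W) ▷ V.X ≫ evA V W
    rw [comp_whiskerRight, Category.assoc, curryAHom_evA, comp_whiskerRight, Category.assoc,
      homAActLeft_evA, associator_naturality_middle_assoc, ← whiskerLeft_comp_assoc,
      curryAHom_evA]
    exact proj_hom_actLeft f
  right_act_hom := by
    apply evA_ext
    change _ = (curryAHom f ▷ A.X ≫ homAActRight V W) ▷ V.X ≫ evA V W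
    rw [comp_whiskerRight, Category.assoc, curryAHom_evA, comp_whiskerRight, Category.assoc,
      homAActRight_evA, associator_naturality_left_assoc, ← whisker_exchange_assoc, curryAHom_evA,
      reassoc_of% proj_condition]

end Bimod

namespace SymmBimod

variable {C : Type u₁} [Category.{v₁} C] [MonoidalCategory C] [RightInternalHom C]
  [BraidedCategory C] [HasEqualizers C] [HasCoequalizers C]
  [∀ X : C, PreservesColimitsOfSize.{0, 0} (tensorLeft X)]
  [∀ X : C, PreservesColimitsOfSize.{0, 0} (tensorRight X)] {A : Mon C}

/-- `hom_A(V, W)` is symmetric if `V` and `W` are. -/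
noncomputable abbrev homA (V W : SymmBimod A) : SymmBimod A :=
  ⟨Bimod.homA V.obj W.obj, by
    refine ⟨halfSymm_homA _ _ V.property.1 W.property.1, ?_⟩
    have h := @halfSymm_homA C _ _ _ A _ (reverseBraiding C) V.obj W.obj
      ((Iso.inv_comp_eq _).2 V.property.2.symm) ((Iso.inv_comp_eq _).2 W.property.2.symm)
    exact ((Iso.inv_comp_eq _).1 h).symm⟩

/-- The internal homs `hom_A` of symmetric bimodules, with `ev^A` and `ζ^A`. -/
noncomputable instance [IsCommMonObj A.X] : RightInternalHom (SymmBimod A) where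
  ihom := homA
  ev V W := ⟨evABimod V.obj W.obj⟩
  curry f := ⟨curryA f.hom⟩
  curry_ev {X V W} f := by
    ext
    rw [← cancel_epi (proj X.obj V.obj)]
    change proj X.obj V.obj ≫ (curryA f.hom ▷ V.obj).hom ≫ (evABimod V.obj W.obj).hom = _
    rw [reassoc_of% proj_whiskerRight, proj_evABimod]
    exact curryAHom_evA f.hom
  curry_unique {X V W} f g h := by
    ext
    apply evA_ext
    have h' := congrArg (fun t => proj X.obj V.obj ≫ t.hom.hom) h
    change proj X.obj V.obj ≫ (g.hom ▷ V.obj).hom ≫ (evABimod V.obj W.obj).hom = _ at h'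
    rw [reassoc_of% proj_whiskerRight, proj_evABimod] at h'
    exact h'.trans (curryAHom_evA f.hom).symm

/-- The inclusion of `hom_A(V, W)` into the internal hom. -/
noncomputable def incl [IsCommMonObj A.X] (V W : SymmBimod A) :
    (ihom V W).obj.X ⟶ ihom V.obj.X W.obj.X :=
  homAIncl V.obj W.obj

theorem curry_incl [IsCommMonObj A.X] {X V W : SymmBimod A} (f : X ⊗ V ⟶ W) :
    (curry f).hom.hom ≫ incl V W = curry (proj X.obj V.obj ≫ f.hom.hom) :=
  equalizer.lift_ι _ _

theorem proj_ev [IsCommMonObj A.X] (V W : SymmBimod A) :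
    proj (ihom V W).obj V.obj ≫ (ev V W).hom.hom = incl V W ▷ V.obj.X ≫ ev V.obj.X W.obj.X :=
  proj_evABimod V.obj W.obj

theorem map_incl [IsCommMonObj A.X] {V W X Y : SymmBimod A} (f : X ⟶ V) (g : W ⟶ Y) :
    (RightInternalHom.map f g).hom.hom ≫ incl X Y =
      incl V W ≫ RightInternalHom.map f.hom.hom g.hom.hom := by
  rw [RightInternalHom.map, curry_incl]
  symm
  apply curry_unique
  rw [RightInternalHom.map, comp_whiskerRight, Category.assoc, curry_ev, ← whisker_exchange_assoc]
  have h := proj_ev V W =≫ g.hom.hom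
  simp only [Category.assoc] at h
  rw [← h, ← reassoc_of% (proj_whiskerLeft (ihom V W).obj f.hom)]
  rfl

end SymmBimod


namespace RightInternalHom

variable {C : Type u₁} [Category.{v₁} C] [MonoidalCategory C] [RightInternalHom C]

instance isLeftAdjoint_tensorRight (V : C) : (tensorRight V).IsLeftAdjoint :=
  (Adjunction.adjunctionOfEquivRight (F := tensorRight V) (G_obj := fun W => ihom V W)
    (fun _ W => 
      { toFun := fun f => curry f
        invFun := fun g => g ▷ V ≫ ev V W
        left_inv := fun f => curry_ev f
        right_inv := fun g => (curry_unique _ g rfl).symm })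
    (fun _ _ _ f g => by
      symm
      apply curry_unique
      rw [comp_whiskerRight, Category.assoc]
      change f ▷ V ≫ curry g ▷ V ≫ ev _ _ = _
      rw [curry_ev]
      rfl)).isLeftAdjoint

instance preserves_tensorRight (V : C) : PreservesColimitsOfSize.{0, 0} (tensorRight V) :=
  (Adjunction.ofIsLeftAdjoint (tensorRight V)).leftAdjoint_preservesColimits

instance preserves_tensorLeft [BraidedCategory C] (V : C) :
    PreservesColimitsOfSize.{0, 0} (tensorLeft V) :=
  preservesColimits_of_natIso (tensorLeftIsoTensorRight V).symm

end RightInternalHom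


open scoped TensorProduct

universe u w

open Algebra.TensorProduct (includeLeft includeRight) in
/-- A quasi-bialgebra over `k`: an algebra `H` with algebra maps `Δ : H → H ⊗ H`, `ε : H → k` and
an invertible `φ ∈ H ⊗ H ⊗ H` (bracketed as `H ⊗ (H ⊗ H)`) such that
`(ε ⊗ id) Δ = id = (id ⊗ ε) Δ`, `(id ⊗ Δ) Δ(h) · φ = φ · (Δ ⊗ id) Δ(h)`,
`(id ⊗ id ⊗ Δ)(φ) · (Δ ⊗ id ⊗ id)(φ) = (1 ⊗ φ) · (id ⊗ Δ ⊗ id)(φ) · (φ ⊗ 1)` and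
`(id ⊗ ε ⊗ id)(φ) = 1 ⊗ 1`. -/
class QuasiBialgebra (k : Type u) (H : Type w) [CommRing k] [Ring H] [Algebra k H] where
  Δ : H →ₐ[k] H ⊗[k] H
  ε : H →ₐ[k] k
  φ : (H ⊗[k] (H ⊗[k] H))ˣ
  counit_left (h : H) :
    Algebra.TensorProduct.lid k H (Algebra.TensorProduct.map ε (AlgHom.id k H) (Δ h)) = h
  counit_right (h : H) :
    Algebra.TensorProduct.rid k k H (Algebra.TensorProduct.map (AlgHom.id k H) ε (Δ h)) = h
  coassoc (h : H) :
    Algebra.TensorProduct.map (AlgHom.id k H) Δ (Δ h) * φ.val =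
      φ.val * Algebra.TensorProduct.assoc k k k H H H
        (Algebra.TensorProduct.map Δ (AlgHom.id k H) (Δ h))
  pentagon :
    Algebra.TensorProduct.map (AlgHom.id k H) (Algebra.TensorProduct.map (AlgHom.id k H) Δ) φ.val *
        Algebra.TensorProduct.assoc k k k H H (H ⊗[k] H)
          (Algebra.TensorProduct.map Δ (AlgHom.id k (H ⊗[k] H)) φ.val) =
      (1 : H) ⊗ₜ[k] φ.val *
        Algebra.TensorProduct.map (AlgHom.id k H)
          ((Algebra.TensorProduct.assoc k k k H H H).toAlgHom.comp
            (Algebra.TensorProduct.map Δ (AlgHom.id k H))) φ.val *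
        Algebra.TensorProduct.map (AlgHom.id k H)
          (Algebra.TensorProduct.map (AlgHom.id k H) includeLeft) φ.val
  counit_mid :
    Algebra.TensorProduct.map (AlgHom.id k H) ((Algebra.TensorProduct.lid k H).toAlgHom.comp
      (Algebra.TensorProduct.map ε (AlgHom.id k H))) φ.val = 1

namespace TAct

variable {k : Type u} [CommSemiring k] {A B C D : Type*} [Semiring A] [Algebra k A] [Semiring B] [Algebra k B]
  [Semiring C] [Algebra k C] [Semiring D] [Algebra k D]
  {U V W X : Type*} [AddCommMonoid U] [Module k U] [AddCommMonoid V] [Module k V]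
  [AddCommMonoid W] [Module k W] [AddCommMonoid X] [Module k X]

theorem lcomp_assoc (f : W →ₗ[k] X) (g : V →ₗ[k] W) (h : U →ₗ[k] V) :
    (f ∘ₗ g) ∘ₗ h = f ∘ₗ (g ∘ₗ h) := by
  apply LinearMap.ext
  intro x
  rfl

/-- The action of `A ⊗ B` on `U ⊗ V`: `(a ⊗ b)(u ⊗ v) = a u ⊗ b v`. -/
noncomputable def tact (ρ : A →ₐ[k] Module.End k U) (σ : B →ₐ[k] Module.End k V) :
    A ⊗[k] B →ₐ[k] Module.End k (U ⊗[k] V) :=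
  Module.endTensorEndAlgHom.comp (Algebra.TensorProduct.map ρ σ)

@[simp]
theorem tact_tmul (ρ : A →ₐ[k] Module.End k U) (σ : B →ₐ[k] Module.End k V) (a : A) (b : B)
    (u : U) (v : V) : tact ρ σ (a ⊗ₜ b) (u ⊗ₜ v) = ρ a u ⊗ₜ σ b v :=
  rfl

theorem tact_map (ρ : A →ₐ[k] Module.End k U) (σ : B →ₐ[k] Module.End k V)
    (f : C →ₐ[k] A) (g : D →ₐ[k] B) (z : C ⊗[k] D) :
    tact ρ σ (Algebra.TensorProduct.map f g z) = tact (ρ.comp f) (σ.comp g) z := by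
  induction z using TensorProduct.induction_on with
  | zero => simp
  | tmul x y => ext; rfl
  | add x y hx hy => simp [hx, hy]

theorem tact_map_right (ρ : A →ₐ[k] Module.End k U) (σ : B →ₐ[k] Module.End k V)
    (g : D →ₐ[k] B) (z : A ⊗[k] D) :
    tact ρ σ (Algebra.TensorProduct.map (AlgHom.id k A) g z) = tact ρ (σ.comp g) z :=
  tact_map ρ σ (AlgHom.id k A) g z

theorem tact_map_left (ρ : A →ₐ[k] Module.End k U) (σ : B →ₐ[k] Module.End k V)
    (f : C →ₐ[k] A) (z : C ⊗[k] B) :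
    tact ρ σ (Algebra.TensorProduct.map f (AlgHom.id k B) z) = tact (ρ.comp f) σ z :=
  tact_map ρ σ f (AlgHom.id k B) z

theorem tact_comp_map_right (ρ : A →ₐ[k] Module.End k U) (σ : B →ₐ[k] Module.End k V)
    (g : D →ₐ[k] B) :
    (tact ρ σ).comp (Algebra.TensorProduct.map (AlgHom.id k A) g) = tact ρ (σ.comp g) :=
  AlgHom.ext fun z => tact_map_right ρ σ g z

theorem tact_comp_map_left (ρ : A →ₐ[k] Module.End k U) (σ : B →ₐ[k] Module.End k V)
    (f : C →ₐ[k] A) :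
    (tact ρ σ).comp (Algebra.TensorProduct.map f (AlgHom.id k B)) = tact (ρ.comp f) σ :=
  AlgHom.ext fun z => tact_map_left ρ σ f z

theorem tact_assoc (ρ : A →ₐ[k] Module.End k U) (σ : B →ₐ[k] Module.End k V)
    (τ : C →ₐ[k] Module.End k W) (z : (A ⊗[k] B) ⊗[k] C) :
    tact ρ (tact σ τ) (Algebra.TensorProduct.assoc k k k A B C z) ∘ₗ
        (TensorProduct.assoc k U V W).toLinearMap =
      (TensorProduct.assoc k U V W).toLinearMap ∘ₗ tact (tact ρ σ) τ z := by
  induction z using TensorProduct.induction_on with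
  | zero => simp
  | add x y hx hy => simp [LinearMap.comp_add, LinearMap.add_comp, hx, hy]
  | tmul x c =>
    induction x using TensorProduct.induction_on with
    | zero => simp
    | add x y hx hy =>
      simp [TensorProduct.add_tmul, LinearMap.comp_add, LinearMap.add_comp, hx, hy]
    | tmul a b => ext; rfl

theorem tact_comm (ρ : A →ₐ[k] Module.End k U) (σ : B →ₐ[k] Module.End k V) (z : A ⊗[k] B) :
    tact σ ρ (Algebra.TensorProduct.comm k A B z) ∘ₗ (TensorProduct.comm k U V).toLinearMap =
      (TensorProduct.comm k U V).toLinearMap ∘ₗ tact ρ σ z := by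
  induction z using TensorProduct.induction_on with
  | zero => simp
  | add x y hx hy => simp [LinearMap.comp_add, LinearMap.add_comp, hx, hy]
  | tmul a b => ext; rfl

/-- Equivariance of a tensor product of equivariant maps. -/
theorem tact_natural (ρ : A →ₐ[k] Module.End k U) (σ : B →ₐ[k] Module.End k V)
    (ρ' : A →ₐ[k] Module.End k W) (σ' : B →ₐ[k] Module.End k X) (f : U →ₗ[k] W) (g : V →ₗ[k] X)
    (hf : ∀ a, f ∘ₗ ρ a = ρ' a ∘ₗ f) (hg : ∀ b, g ∘ₗ σ b = σ' b ∘ₗ g) (z : A ⊗[k] B) :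
    TensorProduct.map f g ∘ₗ tact ρ σ z = tact ρ' σ' z ∘ₗ TensorProduct.map f g := by
  induction z using TensorProduct.induction_on with
  | zero => simp
  | add x y hx hy => simp [LinearMap.comp_add, LinearMap.add_comp, hx, hy]
  | tmul a b =>
    ext u v
    have h1 := LinearMap.congr_fun (hf a) u
    have h2 := LinearMap.congr_fun (hg b) v
    simp at h1 h2
    simp [h1, h2]

end TAct

/-- A left `H`-module: a `k`-module with an algebra map `ρ : H → End_k`. -/
structure HRep (k : Type u) (H : Type w) [CommRing k] [Ring H] [Algebra k H] where
  carrier : Type u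
  [addCommGroup : AddCommGroup carrier]
  [module : Module k carrier]
  ρ : H →ₐ[k] Module.End k carrier

namespace HRep

attribute [instance] addCommGroup module

variable {k : Type u} {H : Type w} [CommRing k] [Ring H] [Algebra k H]

instance : CoeSort (HRep k H) (Type u) := ⟨carrier⟩

/-- `H`-equivariant `k`-linear maps. -/
@[ext]
structure Hom (V W : HRep k H) where
  lin : V →ₗ[k] W
  equivariant (h : H) : lin ∘ₗ V.ρ h = W.ρ h ∘ₗ lin

instance : Category (HRep k H) where
  Hom V W := Hom V W
  id V := ⟨LinearMap.id, fun _ => rfl⟩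
  comp f g := ⟨g.lin ∘ₗ f.lin, fun h => by
    rw [LinearMap.comp_assoc, f.equivariant, ← LinearMap.comp_assoc, g.equivariant,
      LinearMap.comp_assoc]⟩

@[ext]
theorem hom_ext {V W : HRep k H} {f g : V ⟶ W} (h : f.lin = g.lin) : f = g :=
  Hom.ext h

@[simp]
theorem id_lin (V : HRep k H) : (𝟙 V : V ⟶ V).lin = LinearMap.id := rfl

@[simp]
theorem comp_lin {U V W : HRep k H} (f : U ⟶ V) (g : V ⟶ W) : (f ≫ g).lin = g.lin ∘ₗ f.lin := rfl

theorem hom_apply {V W : HRep k H} (f : V ⟶ W) (h : H) (v : V) :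
    f.lin (V.ρ h v) = W.ρ h (f.lin v) :=
  LinearMap.congr_fun (f.equivariant h) v

/-- Isomorphism from an equivariant linear equivalence. -/
def mkIso {V W : HRep k H} (e : V ≃ₗ[k] W)
    (h : ∀ h : H, e.toLinearMap ∘ₗ V.ρ h = W.ρ h ∘ₗ e.toLinearMap) : V ≅ W where
  hom := ⟨e.toLinearMap, h⟩
  inv := ⟨e.symm.toLinearMap, fun a => by
    ext w
    have := LinearMap.congr_fun (h a) (e.symm w)
    simp only [LinearMap.comp_apply, LinearEquiv.coe_coe, LinearEquiv.apply_symm_apply] at this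
    simp [← this]⟩
  hom_inv_id := by ext; simp
  inv_hom_id := by ext; simp

variable [QuasiBialgebra k H]

open QuasiBialgebra TAct

/-- The tensor product over `k`, with `H` acting through `Δ`. -/
noncomputable abbrev tensor (V W : HRep k H) : HRep k H where
  carrier := V ⊗[k] W
  ρ := (tact V.ρ W.ρ).comp Δ

/-- The unit object `k`, with `H` acting through `ε`. -/
noncomputable abbrev unit : HRep k H where
  carrier := k
  ρ := (Algebra.ofId k (Module.End k k)).comp ε

/-- The action of `H ⊗ (H ⊗ H)` on `U ⊗ (V ⊗ W)`, slot by slot. -/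
noncomputable abbrev act3 (U V W : HRep k H) :
    H ⊗[k] (H ⊗[k] H) →ₐ[k] Module.End k (U ⊗[k] (V ⊗[k] W)) :=
  tact U.ρ (tact V.ρ W.ρ)

theorem act3_coassoc (U V W : HRep k H) (h : H) :
    act3 U V W (Algebra.TensorProduct.assoc k k k H H H
        (Algebra.TensorProduct.map Δ (AlgHom.id k H) (Δ h))) ∘ₗ
      (TensorProduct.assoc k U V W).toLinearMap =
    (TensorProduct.assoc k U V W).toLinearMap ∘ₗ (tensor (tensor U V) W).ρ h := by
  rw [tact_assoc, tact_map_left]; rfl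

/-- The action of an invertible element as a linear equivalence. -/
noncomputable def actEquiv {A : Type*} [Semiring A] [Algebra k A] {M : Type*} [AddCommMonoid M]
    [Module k M] (ρ : A →ₐ[k] Module.End k M) (a : Aˣ) : M ≃ₗ[k] M :=
  LinearEquiv.ofLinearMap (ρ a.val) (ρ a.inv)
    (by change ρ a.val * ρ a.inv = 1; rw [← map_mul, a.val_inv, map_one])
    (by change ρ a.inv * ρ a.val = 1; rw [← map_mul, a.inv_val, map_one])

/-- The associator `Φ : (u ⊗ v) ⊗ w ↦ φ · (u ⊗ (v ⊗ w))`. -/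
noncomputable def assocIso (U V W : HRep k H) : tensor (tensor U V) W ≅ tensor U (tensor V W) :=
  mkIso (V := tensor (tensor U V) W) (W := tensor U (tensor V W))
    ((TensorProduct.assoc k U V W).trans (actEquiv (act3 U V W) φ)) (fun h => by
    change (act3 U V W φ.val ∘ₗ (TensorProduct.assoc k U V W).toLinearMap) ∘ₗ
      (tensor (tensor U V) W).ρ h = (tact U.ρ ((tact V.ρ W.ρ).comp Δ)) (Δ h) ∘ₗ
        act3 U V W φ.val ∘ₗ (TensorProduct.assoc k U V W).toLinearMap
    rw [LinearMap.comp_assoc, ← act3_coassoc, ← LinearMap.comp_assoc, ← LinearMap.comp_assoc]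
    congr 1
    have h1 : tact U.ρ ((tact V.ρ W.ρ).comp Δ) (Δ h) =
        act3 U V W (Algebra.TensorProduct.map (AlgHom.id k H) Δ (Δ h)) := by
      rw [tact_map]; rfl
    rw [h1]
    change act3 U V W _ * act3 U V W _ = act3 U V W _ * act3 U V W _
    rw [← map_mul, ← map_mul, coassoc])

theorem assocIso_hom (U V W : HRep k H) : (assocIso U V W).hom.lin =
    act3 U V W φ.val ∘ₗ (TensorProduct.assoc k U V W).toLinearMap := rfl

theorem assocIso_inv (U V W : HRep k H) : (assocIso U V W).inv.lin =
    (TensorProduct.assoc k U V W).symm.toLinearMap ∘ₗ act3 U V W φ.inv := rfl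

/-- The tensor product of two equivariant maps. -/
noncomputable def tensorMap {V W X Y : HRep k H} (f : V ⟶ W) (g : X ⟶ Y) :
    tensor V X ⟶ tensor W Y :=
  ⟨TensorProduct.map f.lin g.lin, fun h =>
    tact_natural V.ρ X.ρ W.ρ Y.ρ f.lin g.lin f.equivariant g.equivariant (Δ h)⟩

/-- The left unitor `c ⊗ v ↦ c v`. -/
noncomputable def lunit (V : HRep k H) : tensor unit V ≅ V :=
  mkIso (V := tensor unit V) (W := V) (TensorProduct.lid k V) (fun h => by
    have key : ∀ z : H ⊗[k] H, (TensorProduct.lid k V).toLinearMap ∘ₗ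
        tact ((Algebra.ofId k (Module.End k k)).comp ε) V.ρ z =
        V.ρ (Algebra.TensorProduct.lid k H (Algebra.TensorProduct.map ε (AlgHom.id k H) z)) ∘ₗ
          (TensorProduct.lid k V).toLinearMap := by
      intro z
      induction z using TensorProduct.induction_on with
      | zero => simp
      | add x y hx hy => simp [LinearMap.comp_add, LinearMap.add_comp, hx, hy]
      | tmul a b => ext; simp [Algebra.ofId_apply]
    refine (key (Δ h)).trans ?_
    rw [counit_left])

/-- The right unitor `v ⊗ c ↦ c v`. -/
noncomputable def runit (V : HRep k H) : tensor V unit ≅ V :=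
  mkIso (V := tensor V unit) (W := V) (TensorProduct.rid k V) (fun h => by
    have key : ∀ z : H ⊗[k] H, (TensorProduct.rid k V).toLinearMap ∘ₗ
        tact V.ρ ((Algebra.ofId k (Module.End k k)).comp ε) z =
        V.ρ (Algebra.TensorProduct.rid k k H (Algebra.TensorProduct.map (AlgHom.id k H) ε z)) ∘ₗ
          (TensorProduct.rid k V).toLinearMap := by
      intro z
      induction z using TensorProduct.induction_on with
      | zero => simp
      | add x y hx hy => simp [LinearMap.comp_add, LinearMap.add_comp, hx, hy]
      | tmul a b => ext; simp [Algebra.ofId_apply]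
    refine (key (Δ h)).trans ?_
    rw [counit_right])

noncomputable instance : MonoidalCategoryStruct (HRep k H) where
  tensorObj := tensor
  tensorUnit := unit
  tensorHom := tensorMap
  whiskerLeft V _ _ f := tensorMap (𝟙 V) f
  whiskerRight f W := tensorMap f (𝟙 W)
  associator := assocIso
  leftUnitor := lunit
  rightUnitor := runit

theorem whiskerLeft_lin (V : HRep k H) {W X : HRep k H} (f : W ⟶ X) :
    (V ◁ f).lin = TensorProduct.map LinearMap.id f.lin := rfl

theorem whiskerRight_lin {V W : HRep k H} (f : V ⟶ W) (X : HRep k H) :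
    (f ▷ X).lin = TensorProduct.map f.lin LinearMap.id := rfl

theorem associator_hom_lin (U V W : HRep k H) : (α_ U V W).hom.lin =
    act3 U V W φ.val ∘ₗ (TensorProduct.assoc k U V W).toLinearMap := rfl

theorem associator_inv_lin (U V W : HRep k H) : (α_ U V W).inv.lin =
    (TensorProduct.assoc k U V W).symm.toLinearMap ∘ₗ act3 U V W φ.inv := rfl

theorem assoc_naturality {U V W U' V' W' : HRep k H} (f : U ⟶ U') (g : V ⟶ V') (h : W ⟶ W') :
    tensorMap (tensorMap f g) h ≫ (assocIso U' V' W').hom =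
      (assocIso U V W).hom ≫ tensorMap f (tensorMap g h) := by
  ext : 1
  change (act3 U' V' W' φ.val ∘ₗ (TensorProduct.assoc k U' V' W').toLinearMap) ∘ₗ
      TensorProduct.map (TensorProduct.map f.lin g.lin) h.lin =
    TensorProduct.map f.lin (TensorProduct.map g.lin h.lin) ∘ₗ act3 U V W φ.val ∘ₗ
      (TensorProduct.assoc k U V W).toLinearMap
  rw [← lcomp_assoc, tact_natural U.ρ (tact V.ρ W.ρ) U'.ρ (tact V'.ρ W'.ρ) f.lin
    (TensorProduct.map g.lin h.lin) f.equivariant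
    (tact_natural V.ρ W.ρ V'.ρ W'.ρ g.lin h.lin g.equivariant h.equivariant) φ.val,
    lcomp_assoc, lcomp_assoc]
  congr 1
  ext
  rfl

section Pentagon

variable {U V W X : Type*} [AddCommMonoid U] [Module k U] [AddCommMonoid V] [Module k V]
  [AddCommMonoid W] [Module k W] [AddCommMonoid X] [Module k X]
  (a : H →ₐ[k] Module.End k U) (b : H →ₐ[k] Module.End k V) (c : H →ₐ[k] Module.End k W)
  (d : H →ₐ[k] Module.End k X)

theorem pentagon_aux1 :
    (tact a (tact b ((tact c d).comp Δ)) φ.val ∘ₗ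
      (TensorProduct.assoc k U V (W ⊗[k] X)).toLinearMap) ∘ₗ
      (tact ((tact a b).comp Δ) (tact c d) φ.val ∘ₗ
        (TensorProduct.assoc k (U ⊗[k] V) W X).toLinearMap) =
    tact a (tact b (tact c d)) (Algebra.TensorProduct.map (AlgHom.id k H)
          (Algebra.TensorProduct.map (AlgHom.id k H) Δ) φ.val *
        Algebra.TensorProduct.assoc k k k H H (H ⊗[k] H)
          (Algebra.TensorProduct.map Δ (AlgHom.id k (H ⊗[k] H)) φ.val)) ∘ₗ
      (TensorProduct.assoc k U V (W ⊗[k] X)).toLinearMap ∘ₗ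
      (TensorProduct.assoc k (U ⊗[k] V) W X).toLinearMap := by
  have h3 := tact_assoc a b (tact c d)
    (Algebra.TensorProduct.map Δ (AlgHom.id k (H ⊗[k] H)) φ.val)
  rw [tact_map_left] at h3
  rw [map_mul, tact_map_right, tact_comp_map_right, Module.End.mul_eq_comp,
    lcomp_assoc, lcomp_assoc]
  congr 1
  rw [← lcomp_assoc, ← lcomp_assoc, h3]

theorem pentagon_aux2 (x y z : H ⊗[k] (H ⊗[k] H)) :
    TensorProduct.map LinearMap.id
        (tact b (tact c d) x ∘ₗ (TensorProduct.assoc k V W X).toLinearMap) ∘ₗ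
      (tact a (tact ((tact b c).comp Δ) d) y ∘ₗ
        (TensorProduct.assoc k U (V ⊗[k] W) X).toLinearMap) ∘ₗ
      TensorProduct.map (tact a (tact b c) z ∘ₗ (TensorProduct.assoc k U V W).toLinearMap)
        LinearMap.id =
    tact a (tact b (tact c d)) ((1 : H) ⊗ₜ[k] x *
        Algebra.TensorProduct.map (AlgHom.id k H)
          ((Algebra.TensorProduct.assoc k k k H H H).toAlgHom.comp
            (Algebra.TensorProduct.map Δ (AlgHom.id k H))) y *
        Algebra.TensorProduct.map (AlgHom.id k H)
          (Algebra.TensorProduct.map (AlgHom.id k H) Algebra.TensorProduct.includeLeft) z) ∘ₗ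
      (TensorProduct.assoc k U V (W ⊗[k] X)).toLinearMap ∘ₗ
      (TensorProduct.assoc k (U ⊗[k] V) W X).toLinearMap := by
  have h1 : TensorProduct.map (LinearMap.id : U →ₗ[k] U)
      (tact b (tact c d) x ∘ₗ (TensorProduct.assoc k V W X).toLinearMap) =
      tact a (tact b (tact c d)) ((1 : H) ⊗ₜ[k] x) ∘ₗ
        TensorProduct.map LinearMap.id (TensorProduct.assoc k V W X).toLinearMap := by
    apply TensorProduct.ext'
    intro u v
    simp
  have h2 : TensorProduct.map (LinearMap.id : U →ₗ[k] U)
        (TensorProduct.assoc k V W X).toLinearMap ∘ₗ tact a (tact ((tact b c).comp Δ) d) y =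
      tact a (tact b (tact c d)) (Algebra.TensorProduct.map (AlgHom.id k H)
          ((Algebra.TensorProduct.assoc k k k H H H).toAlgHom.comp
            (Algebra.TensorProduct.map Δ (AlgHom.id k H))) y) ∘ₗ
        TensorProduct.map LinearMap.id (TensorProduct.assoc k V W X).toLinearMap := by
    rw [tact_map_right]
    apply tact_natural
    · intro _; rfl
    · intro e
      rw [AlgHom.comp_apply, AlgHom.comp_apply, ← tact_map_left]
      exact (tact_assoc _ _ _ _).symm
  have h3 : TensorProduct.map (LinearMap.id : U →ₗ[k] U)
        (TensorProduct.assoc k V W X).toLinearMap ∘ₗ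
      (TensorProduct.assoc k U (V ⊗[k] W) X).toLinearMap ∘ₗ
      TensorProduct.map (tact a (tact b c) z ∘ₗ (TensorProduct.assoc k U V W).toLinearMap)
        LinearMap.id =
      tact a (tact b (tact c d)) (Algebra.TensorProduct.map (AlgHom.id k H)
          (Algebra.TensorProduct.map (AlgHom.id k H) Algebra.TensorProduct.includeLeft) z) ∘ₗ
      (TensorProduct.assoc k U V (W ⊗[k] X)).toLinearMap ∘ₗ
      (TensorProduct.assoc k (U ⊗[k] V) W X).toLinearMap := by
    induction z using TensorProduct.induction_on with
    | zero => simp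
    | add x y hx hy =>
      simp only [map_add, LinearMap.add_comp, TensorProduct.map_add_left, LinearMap.comp_add,
        hx, hy]
    | tmul p z =>
      induction z using TensorProduct.induction_on with
      | zero => simp
      | add x y hx hy =>
        simp only [TensorProduct.tmul_add, map_add, LinearMap.add_comp, TensorProduct.map_add_left,
          LinearMap.comp_add, hx, hy]
      | tmul q r =>
        ext
        simp
  rw [map_mul, map_mul, Module.End.mul_eq_comp, Module.End.mul_eq_comp, h1]
  simp only [lcomp_assoc]
  rw [← h3, ← lcomp_assoc (TensorProduct.map _ _) (tact a _ _) _, h2]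
  simp only [lcomp_assoc]

theorem triangle_aux (z : H ⊗[k] (H ⊗[k] H)) :
    TensorProduct.map LinearMap.id (TensorProduct.lid k V).toLinearMap ∘ₗ
      tact a (tact ((Algebra.ofId k (Module.End k k)).comp ε) b) z ∘ₗ
        (TensorProduct.assoc k U k V).toLinearMap =
    tact a b (Algebra.TensorProduct.map (AlgHom.id k H) ((Algebra.TensorProduct.lid k H).toAlgHom.comp
      (Algebra.TensorProduct.map ε (AlgHom.id k H))) z) ∘ₗ
      TensorProduct.map (TensorProduct.rid k U).toLinearMap LinearMap.id := by
  induction z using TensorProduct.induction_on with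
  | zero => simp
  | add x y hx hy => simp only [map_add, LinearMap.add_comp, LinearMap.comp_add, hx, hy]
  | tmul p z =>
    induction z using TensorProduct.induction_on with
    | zero => simp
    | add x y hx hy =>
      simp only [TensorProduct.tmul_add, map_add, LinearMap.add_comp, LinearMap.comp_add, hx, hy]
    | tmul q r =>
      ext
      simp [Algebra.ofId_apply]

end Pentagon

noncomputable instance : MonoidalCategory (HRep k H) where
  tensorHom_def f g := by
    ext : 1
    change TensorProduct.map f.lin g.lin = TensorProduct.map LinearMap.id g.lin ∘ₗ
      TensorProduct.map f.lin LinearMap.id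
    rw [← TensorProduct.map_comp]; rfl
  id_tensorHom_id V W := by
    ext : 1
    exact TensorProduct.map_id
  tensorHom_comp_tensorHom f g f' g' := by
    ext : 1
    exact (TensorProduct.map_comp _ _ _ _).symm
  whiskerLeft_id V W := by
    ext : 1
    exact TensorProduct.map_id
  id_whiskerRight V W := by
    ext : 1
    exact TensorProduct.map_id
  associator_naturality f g h := assoc_naturality f g h
  leftUnitor_naturality f := by
    ext : 1
    apply TensorProduct.ext'
    intro x v
    exact (TensorProduct.lid_tmul _ _).trans (map_smul f.lin x v).symm
  rightUnitor_naturality f := by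
    ext : 1
    apply TensorProduct.ext'
    intro v x
    exact (TensorProduct.rid_tmul _ _).trans (map_smul f.lin x v).symm
  pentagon U V W X := by
    ext : 1
    refine (pentagon_aux2 U.ρ V.ρ W.ρ X.ρ φ.val φ.val φ.val).trans ?_
    rw [← QuasiBialgebra.pentagon]
    exact (pentagon_aux1 U.ρ V.ρ W.ρ X.ρ).symm
  triangle U V := by
    ext : 1
    refine (triangle_aux U.ρ V.ρ φ.val).trans ?_
    rw [counit_mid, map_one]
    rfl

end HRep


/-- `leg i x` has `x` in slot `i` (numbered 0, 1, 2) of `H ⊗ (H ⊗ H)` and `1` in the others. -/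
noncomputable def leg (k : Type u) (H : Type w) [CommRing k] [Ring H] [Algebra k H] :
    Fin 3 → H →ₗ[k] H ⊗[k] (H ⊗[k] H) :=
  ![(TensorProduct.mk k H (H ⊗[k] H)).flip (1 ⊗ₜ 1),
    TensorProduct.mk k H (H ⊗[k] H) 1 ∘ₗ (TensorProduct.mk k H H).flip 1,
    TensorProduct.mk k H (H ⊗[k] H) 1 ∘ₗ TensorProduct.mk k H H 1]

/-- `legs2 i j (x ⊗ y)` is the element of `H ⊗ (H ⊗ H)` with `x` in slot `i` and `y` in slot `j`
(`i ≠ j`, slots numbered 0, 1, 2); what is usually written `R_{13}` is `legs2 0 2 R`. -/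
noncomputable def legs2 {k : Type u} {H : Type w} [CommRing k] [Ring H] [Algebra k H]
    (i j : Fin 3) : H ⊗[k] H →ₗ[k] H ⊗[k] (H ⊗[k] H) :=
  LinearMap.mul' k (H ⊗[k] (H ⊗[k] H)) ∘ₗ TensorProduct.map (leg k H i) (leg k H j)

/-- `legs3 i j l (x ⊗ y ⊗ z)` has `x` in slot `i`, `y` in slot `j` and `z` in slot `l`; what is
usually written `φ_{231}` is `legs3 1 2 0 φ`. -/
noncomputable def legs3 {k : Type u} {H : Type w} [CommRing k] [Ring H] [Algebra k H]
    (i j l : Fin 3) : H ⊗[k] (H ⊗[k] H) →ₗ[k] H ⊗[k] (H ⊗[k] H) :=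
  LinearMap.mul' k (H ⊗[k] (H ⊗[k] H)) ∘ₗ TensorProduct.map (leg k H i) (legs2 j l)

open QuasiBialgebra in
/-- A quasitriangular structure: an invertible `R ∈ H ⊗ H` with `Δ^op(h) = R Δ(h) R⁻¹`,
`(id ⊗ Δ)(R) = (φ_{231})⁻¹ R_{13} φ_{213} R_{12} φ⁻¹` and
`(Δ ⊗ id)(R) = φ_{312} R_{13} (φ_{132})⁻¹ R_{23} φ`. -/
class Quasitriangular (k : Type u) (H : Type w) [CommRing k] [Ring H] [Algebra k H]
    [QuasiBialgebra k H] where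
  R : (H ⊗[k] H)ˣ
  comul_op (h : H) : Algebra.TensorProduct.comm k H H (Δ h) = R.val * Δ h * R.inv
  hexagon_right :
    Algebra.TensorProduct.map (AlgHom.id k H) Δ R.val =
      legs3 1 2 0 φ.inv * legs2 0 2 R.val * legs3 1 0 2 φ.val * legs2 0 1 R.val * φ.inv
  hexagon_left :
    Algebra.TensorProduct.assoc k k k H H H (Algebra.TensorProduct.map Δ (AlgHom.id k H) R.val) =
      legs3 2 0 1 φ.val * legs2 0 2 R.val * legs3 0 2 1 φ.inv * legs2 1 2 R.val * φ.val

namespace HRep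

open QuasiBialgebra Quasitriangular TAct

variable {k : Type u} {H : Type w} [CommRing k] [Ring H] [Algebra k H]

section
variable {U V W : Type*} [AddCommMonoid U] [Module k U] [AddCommMonoid V] [Module k V]
  [AddCommMonoid W] [Module k W]
  (a : H →ₐ[k] Module.End k U) (b : H →ₐ[k] Module.End k V) (c : H →ₐ[k] Module.End k W)

variable (k U V W) in
/-- `u ⊗ (v ⊗ w) ↦ v ⊗ (w ⊗ u)`. -/
noncomputable def cyc : U ⊗[k] (V ⊗[k] W) →ₗ[k] V ⊗[k] (W ⊗[k] U) :=
  (TensorProduct.assoc k V W U).toLinearMap ∘ₗ (TensorProduct.comm k U (V ⊗[k] W)).toLinearMap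

variable (k U V W) in
noncomputable def cycInv : U ⊗[k] (V ⊗[k] W) →ₗ[k] W ⊗[k] (U ⊗[k] V) :=
  (TensorProduct.comm k (U ⊗[k] V) W).toLinearMap ∘ₗ (TensorProduct.assoc k U V W).symm.toLinearMap

variable (k U V W) in
noncomputable def swap12 : U ⊗[k] (V ⊗[k] W) →ₗ[k] V ⊗[k] (U ⊗[k] W) :=
  (TensorProduct.leftComm k U V W).toLinearMap

variable (k U V W) in
noncomputable def swap23 : U ⊗[k] (V ⊗[k] W) →ₗ[k] U ⊗[k] (W ⊗[k] V) :=
  TensorProduct.map LinearMap.id (TensorProduct.comm k V W).toLinearMap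

/-- The action of `R` followed by the flip. -/
noncomputable def flipAct (z : H ⊗[k] H) : U ⊗[k] V →ₗ[k] V ⊗[k] U :=
  (TensorProduct.comm k U V).toLinearMap ∘ₗ tact a b z

theorem act_cyc (z : H ⊗[k] (H ⊗[k] H)) :
    tact b (tact c a) z ∘ₗ cyc k U V W = cyc k U V W ∘ₗ tact a (tact b c) (legs3 1 2 0 z) := by
  induction z using TensorProduct.induction_on with
  | zero => simp
  | add x y hx hy => simp only [map_add, LinearMap.add_comp, LinearMap.comp_add, hx, hy]
  | tmul p z =>
    induction z using TensorProduct.induction_on with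
    | zero => simp
    | add x y hx hy =>
      simp only [TensorProduct.tmul_add, map_add, LinearMap.add_comp, LinearMap.comp_add, hx, hy]
    | tmul q r =>
      ext
      simp [cyc, legs3, legs2, leg]

theorem act_cycInv (z : H ⊗[k] (H ⊗[k] H)) :
    tact c (tact a b) z ∘ₗ cycInv k U V W =
      cycInv k U V W ∘ₗ tact a (tact b c) (legs3 2 0 1 z) := by
  induction z using TensorProduct.induction_on with
  | zero => simp
  | add x y hx hy => simp only [map_add, LinearMap.add_comp, LinearMap.comp_add, hx, hy]
  | tmul p z =>
    induction z using TensorProduct.induction_on with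
    | zero => simp
    | add x y hx hy =>
      simp only [TensorProduct.tmul_add, map_add, LinearMap.add_comp, LinearMap.comp_add, hx, hy]
    | tmul q r =>
      ext
      simp [cycInv, legs3, legs2, leg]

theorem act_swap12 (z : H ⊗[k] (H ⊗[k] H)) :
    tact b (tact a c) z ∘ₗ swap12 k U V W =
      swap12 k U V W ∘ₗ tact a (tact b c) (legs3 1 0 2 z) := by
  induction z using TensorProduct.induction_on with
  | zero => simp
  | add x y hx hy => simp only [map_add, LinearMap.add_comp, LinearMap.comp_add, hx, hy]
  | tmul p z =>
    induction z using TensorProduct.induction_on with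
    | zero => simp
    | add x y hx hy =>
      simp only [TensorProduct.tmul_add, map_add, LinearMap.add_comp, LinearMap.comp_add, hx, hy]
    | tmul q r =>
      ext
      simp [swap12, legs3, legs2, leg]

theorem act_swap23 (z : H ⊗[k] (H ⊗[k] H)) :
    tact a (tact c b) z ∘ₗ swap23 k U V W =
      swap23 k U V W ∘ₗ tact a (tact b c) (legs3 0 2 1 z) := by
  induction z using TensorProduct.induction_on with
  | zero => simp
  | add x y hx hy => simp only [map_add, LinearMap.add_comp, LinearMap.comp_add, hx, hy]
  | tmul p z =>
    induction z using TensorProduct.induction_on with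
    | zero => simp
    | add x y hx hy =>
      simp only [TensorProduct.tmul_add, map_add, LinearMap.add_comp, LinearMap.comp_add, hx, hy]
    | tmul q r =>
      ext
      simp [swap23, legs3, legs2, leg]

theorem flipAct_right (z : H ⊗[k] H) :
    TensorProduct.map LinearMap.id (flipAct a c z) ∘ₗ swap12 k U V W =
      cyc k U V W ∘ₗ tact a (tact b c) (legs2 0 2 z) := by
  induction z using TensorProduct.induction_on with
  | zero => simp [flipAct]
  | add x y hx hy =>
    simp only [flipAct, map_add, LinearMap.add_comp, LinearMap.comp_add,
      TensorProduct.map_add_right] at hx hy ⊢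
    rw [hx, hy]
  | tmul q r =>
    ext
    simp [flipAct, swap12, cyc, legs2, leg]

theorem flipAct_left (z : H ⊗[k] H) :
    (TensorProduct.assoc k V U W).toLinearMap ∘ₗ
        TensorProduct.map (flipAct a b z) LinearMap.id =
      swap12 k U V W ∘ₗ tact a (tact b c) (legs2 0 1 z) ∘ₗ
        (TensorProduct.assoc k U V W).toLinearMap := by
  induction z using TensorProduct.induction_on with
  | zero => simp [flipAct]
  | add x y hx hy =>
    simp only [flipAct, map_add, LinearMap.add_comp, LinearMap.comp_add,
      TensorProduct.map_add_left] at hx hy ⊢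
    rw [hx, hy]
  | tmul q r =>
    ext
    simp [flipAct, swap12, legs2, leg]

theorem flipAct_right' (z : H ⊗[k] H) :
    TensorProduct.map LinearMap.id (flipAct b c z) =
      swap23 k U V W ∘ₗ tact a (tact b c) (legs2 1 2 z) := by
  induction z using TensorProduct.induction_on with
  | zero => simp [flipAct]
  | add x y hx hy =>
    simp only [flipAct, map_add, LinearMap.comp_add, TensorProduct.map_add_right] at hx hy ⊢
    rw [hx, hy]
  | tmul q r =>
    ext
    simp [flipAct, swap23, legs2, leg]

theorem flipAct_left' (z : H ⊗[k] H) :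
    TensorProduct.map (flipAct a c z) LinearMap.id ∘ₗ
        (TensorProduct.assoc k U W V).symm.toLinearMap ∘ₗ swap23 k U V W =
      (TensorProduct.assoc k W U V).symm.toLinearMap ∘ₗ cycInv k U V W ∘ₗ
        tact a (tact b c) (legs2 0 2 z) := by
  induction z using TensorProduct.induction_on with
  | zero => simp [flipAct]
  | add x y hx hy =>
    simp only [flipAct, map_add, LinearMap.add_comp, LinearMap.comp_add,
      TensorProduct.map_add_left] at hx hy ⊢
    rw [hx, hy]
  | tmul q r =>
    ext
    simp [flipAct, swap23, cycInv, legs2, leg]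

variable [QuasiBialgebra k H] [Quasitriangular k H]

theorem hexagon_aux1 :
    (tact b (tact c a) φ.val ∘ₗ (TensorProduct.assoc k V W U).toLinearMap) ∘ₗ
      flipAct a ((tact b c).comp Δ) R.val ∘ₗ
      (tact a (tact b c) φ.val ∘ₗ (TensorProduct.assoc k U V W).toLinearMap) =
    TensorProduct.map LinearMap.id (flipAct a c R.val) ∘ₗ
      (tact b (tact a c) φ.val ∘ₗ (TensorProduct.assoc k V U W).toLinearMap) ∘ₗ
      TensorProduct.map (flipAct a b R.val) LinearMap.id := by
  have h0 : tact b (tact c a) φ.val ∘ₗ cyc k U V W ∘ₗ tact a (tact b c) (legs3 1 2 0 φ.inv) =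
      cyc k U V W := by
    rw [← act_cyc, ← LinearMap.comp_assoc, ← Module.End.mul_eq_comp, ← map_mul, φ.val_inv, map_one, Module.End.one_eq_id,
      LinearMap.id_comp]
  have h1 : tact a ((tact b c).comp Δ) R.val ∘ₗ tact a (tact b c) φ.val =
      tact a (tact b c) (legs3 1 2 0 φ.inv) ∘ₗ tact a (tact b c) (legs2 0 2 R.val) ∘ₗ
      tact a (tact b c) (legs3 1 0 2 φ.val) ∘ₗ tact a (tact b c) (legs2 0 1 R.val) := by
    rw [← tact_map_right, hexagon_right]
    simp only [← Module.End.mul_eq_comp, ← map_mul, mul_assoc]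
    rw [φ.inv_val, mul_one]
  calc
    _ = tact b (tact c a) φ.val ∘ₗ cyc k U V W ∘ₗ
        (tact a ((tact b c).comp Δ) R.val ∘ₗ tact a (tact b c) φ.val) ∘ₗ
        (TensorProduct.assoc k U V W).toLinearMap := by
      simp only [flipAct, cyc, lcomp_assoc]
    _ = (tact b (tact c a) φ.val ∘ₗ cyc k U V W ∘ₗ tact a (tact b c) (legs3 1 2 0 φ.inv)) ∘ₗ
        tact a (tact b c) (legs2 0 2 R.val) ∘ₗ
        tact a (tact b c) (legs3 1 0 2 φ.val) ∘ₗ tact a (tact b c) (legs2 0 1 R.val) ∘ₗ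
        (TensorProduct.assoc k U V W).toLinearMap := by rw [h1]; simp only [lcomp_assoc]
    _ = (cyc k U V W ∘ₗ tact a (tact b c) (legs2 0 2 R.val)) ∘ₗ
        tact a (tact b c) (legs3 1 0 2 φ.val) ∘ₗ tact a (tact b c) (legs2 0 1 R.val) ∘ₗ
        (TensorProduct.assoc k U V W).toLinearMap := by rw [h0]; simp only [lcomp_assoc]
    _ = TensorProduct.map LinearMap.id (flipAct a c R.val) ∘ₗ
        (swap12 k U V W ∘ₗ
        tact a (tact b c) (legs3 1 0 2 φ.val)) ∘ₗ tact a (tact b c) (legs2 0 1 R.val) ∘ₗ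
        (TensorProduct.assoc k U V W).toLinearMap := by rw [← flipAct_right]; simp only [lcomp_assoc]
    _ = TensorProduct.map LinearMap.id (flipAct a c R.val) ∘ₗ tact b (tact a c) φ.val ∘ₗ
        (swap12 k U V W ∘ₗ tact a (tact b c) (legs2 0 1 R.val) ∘ₗ
        (TensorProduct.assoc k U V W).toLinearMap) := by rw [← act_swap12]; simp only [lcomp_assoc]
    _ = _ := by rw [← flipAct_left]; simp only [lcomp_assoc]

theorem hexagon_aux2 :
    ((TensorProduct.assoc k W U V).symm.toLinearMap ∘ₗ tact c (tact a b) φ.inv) ∘ₗ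
      flipAct ((tact a b).comp Δ) c R.val ∘ₗ
      ((TensorProduct.assoc k U V W).symm.toLinearMap ∘ₗ tact a (tact b c) φ.inv) =
    TensorProduct.map (flipAct a c R.val) LinearMap.id ∘ₗ
      ((TensorProduct.assoc k U W V).symm.toLinearMap ∘ₗ tact a (tact c b) φ.inv) ∘ₗ
      TensorProduct.map LinearMap.id (flipAct b c R.val) := by
  have h0 : tact c (tact a b) φ.inv ∘ₗ cycInv k U V W ∘ₗ tact a (tact b c) (legs3 2 0 1 φ.val) =
      cycInv k U V W := by
    rw [← act_cycInv, ← LinearMap.comp_assoc, ← Module.End.mul_eq_comp, ← map_mul, φ.inv_val,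
      map_one, Module.End.one_eq_id,
      LinearMap.id_comp]
  have h1 : tact ((tact a b).comp Δ) c R.val ∘ₗ (TensorProduct.assoc k U V W).symm.toLinearMap =
      (TensorProduct.assoc k U V W).symm.toLinearMap ∘ₗ tact a (tact b c)
        (Algebra.TensorProduct.assoc k k k H H H
          (Algebra.TensorProduct.map Δ (AlgHom.id k H) R.val)) := by
    have h := tact_assoc a b c (Algebra.TensorProduct.map Δ (AlgHom.id k H) R.val)
    rw [tact_map_left] at h
    apply LinearMap.ext
    intro x
    have hx := LinearMap.congr_fun h ((TensorProduct.assoc k U V W).symm x)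
    simp only [LinearMap.comp_apply, LinearEquiv.coe_coe, LinearEquiv.apply_symm_apply] at hx ⊢
    rw [hx, LinearEquiv.symm_apply_apply]
  have h2 : tact a (tact b c) (Algebra.TensorProduct.assoc k k k H H H
          (Algebra.TensorProduct.map Δ (AlgHom.id k H) R.val)) ∘ₗ tact a (tact b c) φ.inv =
      tact a (tact b c) (legs3 2 0 1 φ.val) ∘ₗ tact a (tact b c) (legs2 0 2 R.val) ∘ₗ
      tact a (tact b c) (legs3 0 2 1 φ.inv) ∘ₗ tact a (tact b c) (legs2 1 2 R.val) := by
    rw [hexagon_left]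
    simp only [← Module.End.mul_eq_comp, ← map_mul, mul_assoc]
    rw [φ.val_inv, mul_one]
  calc
    _ = (TensorProduct.assoc k W U V).symm.toLinearMap ∘ₗ tact c (tact a b) φ.inv ∘ₗ
        (TensorProduct.comm k (U ⊗[k] V) W).toLinearMap ∘ₗ
        (tact ((tact a b).comp Δ) c R.val ∘ₗ (TensorProduct.assoc k U V W).symm.toLinearMap) ∘ₗ
        tact a (tact b c) φ.inv := by
      simp only [flipAct, lcomp_assoc]
    _ = (TensorProduct.assoc k W U V).symm.toLinearMap ∘ₗ tact c (tact a b) φ.inv ∘ₗ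
        cycInv k U V W ∘ₗ
        (tact a (tact b c) (Algebra.TensorProduct.assoc k k k H H H
          (Algebra.TensorProduct.map Δ (AlgHom.id k H) R.val)) ∘ₗ
        tact a (tact b c) φ.inv) := by rw [h1]; simp only [cycInv, lcomp_assoc]
    _ = (TensorProduct.assoc k W U V).symm.toLinearMap ∘ₗ (tact c (tact a b) φ.inv ∘ₗ
        cycInv k U V W ∘ₗ tact a (tact b c) (legs3 2 0 1 φ.val)) ∘ₗ
        tact a (tact b c) (legs2 0 2 R.val) ∘ₗ
        tact a (tact b c) (legs3 0 2 1 φ.inv) ∘ₗ tact a (tact b c) (legs2 1 2 R.val) := by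
      rw [h2]; simp only [lcomp_assoc]
    _ = ((TensorProduct.assoc k W U V).symm.toLinearMap ∘ₗ cycInv k U V W ∘ₗ
        tact a (tact b c) (legs2 0 2 R.val)) ∘ₗ
        tact a (tact b c) (legs3 0 2 1 φ.inv) ∘ₗ tact a (tact b c) (legs2 1 2 R.val) := by
      rw [h0]; simp only [lcomp_assoc]
    _ = TensorProduct.map (flipAct a c R.val) LinearMap.id ∘ₗ
        (TensorProduct.assoc k U W V).symm.toLinearMap ∘ₗ (swap23 k U V W ∘ₗ
        tact a (tact b c) (legs3 0 2 1 φ.inv)) ∘ₗ tact a (tact b c) (legs2 1 2 R.val) := by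
      rw [← flipAct_left']; simp only [lcomp_assoc]
    _ = TensorProduct.map (flipAct a c R.val) LinearMap.id ∘ₗ
        (TensorProduct.assoc k U W V).symm.toLinearMap ∘ₗ tact a (tact c b) φ.inv ∘ₗ
        (swap23 k U V W ∘ₗ tact a (tact b c) (legs2 1 2 R.val)) := by
      rw [← act_swap23]; simp only [lcomp_assoc]
    _ = _ := by rw [← flipAct_right']; simp only [lcomp_assoc]

end

section Braiding

variable [QuasiBialgebra k H] [Quasitriangular k H]

theorem comul_op' (h : H) :
    Algebra.TensorProduct.comm k H H (Δ h) * R.val = R.val * Δ h := by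
  rw [comul_op, mul_assoc, R.inv_val, mul_one]

/-- The braiding `τ(v ⊗ w) = R² w ⊗ R¹ v`, where `R = R¹ ⊗ R²`. -/
noncomputable def braidIso (V W : HRep k H) : V ⊗ W ≅ W ⊗ V :=
  mkIso (V := tensor V W) (W := tensor W V)
    ((actEquiv (tact V.ρ W.ρ) R).trans (TensorProduct.comm k V W)) (fun h => by
      change (TensorProduct.comm k V W).toLinearMap ∘ₗ
          (tact V.ρ W.ρ R.val * tact V.ρ W.ρ (Δ h)) =
        tact W.ρ V.ρ (Δ h) ∘ₗ (TensorProduct.comm k V W).toLinearMap ∘ₗ tact V.ρ W.ρ R.val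
      have hc := tact_comm V.ρ W.ρ (Algebra.TensorProduct.comm k H H (Δ h))
      have hcc : Algebra.TensorProduct.comm k H H (Algebra.TensorProduct.comm k H H (Δ h)) =
          Δ h := (Algebra.TensorProduct.comm k H H).symm_apply_apply (Δ h)
      rw [hcc] at hc
      rw [← LinearMap.comp_assoc, hc, ← map_mul, ← comul_op', map_mul]
      rfl)

theorem braidIso_lin (V W : HRep k H) :
    (braidIso V W).hom.lin = flipAct V.ρ W.ρ R.val := rfl

noncomputable instance : BraidedCategory (HRep k H) where
  braiding := braidIso
  braiding_naturality_right V {W X} f := by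
    ext : 1
    change (TensorProduct.comm k V X).toLinearMap ∘ₗ tact V.ρ X.ρ R.val ∘ₗ
        TensorProduct.map LinearMap.id f.lin =
      TensorProduct.map f.lin LinearMap.id ∘ₗ (TensorProduct.comm k V W).toLinearMap ∘ₗ
        tact V.ρ W.ρ R.val
    rw [← tact_natural V.ρ W.ρ V.ρ X.ρ LinearMap.id f.lin (fun _ => rfl) f.equivariant,
      ← LinearMap.comp_assoc, ← LinearMap.comp_assoc]
    congr 1
    ext
    rfl
  braiding_naturality_left {V W} f X := by
    ext : 1
    change (TensorProduct.comm k W X).toLinearMap ∘ₗ tact W.ρ X.ρ R.val ∘ₗ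
        TensorProduct.map f.lin LinearMap.id =
      TensorProduct.map LinearMap.id f.lin ∘ₗ (TensorProduct.comm k V X).toLinearMap ∘ₗ
        tact V.ρ X.ρ R.val
    rw [← tact_natural V.ρ X.ρ W.ρ X.ρ f.lin LinearMap.id f.equivariant (fun _ => rfl),
      ← LinearMap.comp_assoc, ← LinearMap.comp_assoc]
    congr 1
    ext
    rfl
  hexagon_forward U V W := by
    ext : 1
    exact hexagon_aux1 U.ρ V.ρ W.ρ
  hexagon_reverse U V W := by
    ext : 1
    exact hexagon_aux2 U.ρ V.ρ W.ρ

end Braiding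

end HRep


section QuasiHopf

variable {k : Type u} {H : Type w} [CommRing k] [Ring H] [Algebra k H]

/-- The antipode as a linear map `H → H`; an isomorphism of algebras from `H` to the opposite
algebra is an algebra anti-automorphism of `H`. -/
def antiMap (S : H ≃ₐ[k] Hᵐᵒᵖ) : H →ₗ[k] H :=
  (MulOpposite.opLinearEquiv k).symm.toLinearMap ∘ₗ S.toLinearMap

/-- `x ⊗ y ↦ S(x) a y` -/
noncomputable def sandLeft (S : H ≃ₐ[k] Hᵐᵒᵖ) (a : H) : H ⊗[k] H →ₗ[k] H :=
  LinearMap.mul' k H ∘ₗ TensorProduct.map (LinearMap.mulRight k a ∘ₗ antiMap S) LinearMap.id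

/-- `x ⊗ y ↦ x b S(y)` -/
noncomputable def sandRight (S : H ≃ₐ[k] Hᵐᵒᵖ) (b : H) : H ⊗[k] H →ₗ[k] H :=
  LinearMap.mul' k H ∘ₗ TensorProduct.map (LinearMap.mulRight k b) (antiMap S)

/-- `x ⊗ y ⊗ z ↦ x b S(y) a z` -/
noncomputable def zigzag (S : H ≃ₐ[k] Hᵐᵒᵖ) (a b : H) : H ⊗[k] (H ⊗[k] H) →ₗ[k] H :=
  LinearMap.mul' k H ∘ₗ TensorProduct.map (LinearMap.mulRight k b) (sandLeft S a)

/-- `x ⊗ y ⊗ z ↦ S(x) a y b S(z)` -/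
noncomputable def zagzig (S : H ≃ₐ[k] Hᵐᵒᵖ) (a b : H) : H ⊗[k] (H ⊗[k] H) →ₗ[k] H :=
  LinearMap.mul' k H ∘ₗ TensorProduct.map (LinearMap.mulRight k a ∘ₗ antiMap S) (sandRight S b)

theorem antiMap_mul (S : H ≃ₐ[k] Hᵐᵒᵖ) (x y : H) :
    antiMap S (x * y) = antiMap S y * antiMap S x := by
  simp [antiMap]

theorem antiMap_one (S : H ≃ₐ[k] Hᵐᵒᵖ) : antiMap S 1 = 1 := by
  simp [antiMap]

theorem sandLeft_tmul (S : H ≃ₐ[k] Hᵐᵒᵖ) (a x y : H) :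
    sandLeft S a (x ⊗ₜ y) = antiMap S x * a * y := rfl

theorem sandRight_tmul (S : H ≃ₐ[k] Hᵐᵒᵖ) (b x y : H) :
    sandRight S b (x ⊗ₜ y) = x * b * antiMap S y := rfl

theorem zigzag_tmul (S : H ≃ₐ[k] Hᵐᵒᵖ) (a b x y z : H) :
    zigzag S a b (x ⊗ₜ (y ⊗ₜ z)) = x * b * (antiMap S y * a * z) := rfl

theorem zagzig_tmul (S : H ≃ₐ[k] Hᵐᵒᵖ) (a b x y z : H) :
    zagzig S a b (x ⊗ₜ (y ⊗ₜ z)) = antiMap S x * a * (y * b * antiMap S z) := rfl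

end QuasiHopf

/-- A quasi-Hopf algebra: a quasi-bialgebra with an algebra anti-automorphism `S` and elements
`α, β` such that, in Sweedler notation, `S(h₁) α h₂ = ε(h) α`, `h₁ β S(h₂) = ε(h) β`,
`φ¹ β S(φ²) α φ³ = 1` and `S(φ⁻¹) α φ⁻² β S(φ⁻³) = 1`. -/
class QuasiHopfAlgebra (k : Type u) (H : Type w) [CommRing k] [Ring H] [Algebra k H] extends
    QuasiBialgebra k H where
  S : H ≃ₐ[k] Hᵐᵒᵖ
  α : H
  β : H
  antipode_left (h : H) : sandLeft S α (Δ h) = ε h • α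
  antipode_right (h : H) : sandRight S β (Δ h) = ε h • β
  zigzag_φ : zigzag S α β φ.val = 1
  zagzig_φ_inv : zagzig S α β φ.inv = 1

section Contraction

open QuasiBialgebra

variable {k : Type u} {H : Type w} [CommRing k] [Ring H] [Algebra k H]

section Counit

variable [QuasiBialgebra k H]

variable (k H) in
/-- `id ⊗ id ⊗ ε` -/
noncomputable def epsThree : H ⊗[k] (H ⊗[k] H) →ₐ[k] H ⊗[k] H :=
  Algebra.TensorProduct.map (AlgHom.id k H) ((Algebra.TensorProduct.rid k k H).toAlgHom.comp
    (Algebra.TensorProduct.map (AlgHom.id k H) ε))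

variable (k H) in
/-- `id ⊗ ε ⊗ id` -/
noncomputable def epsTwo : H ⊗[k] (H ⊗[k] H) →ₐ[k] H ⊗[k] H :=
  Algebra.TensorProduct.map (AlgHom.id k H) ((Algebra.TensorProduct.lid k H).toAlgHom.comp
    (Algebra.TensorProduct.map ε (AlgHom.id k H)))

theorem epsThree_φ : epsThree k H φ.val = 1 := by
  let m : H ⊗[k] (H ⊗[k] (H ⊗[k] H)) →ₐ[k] H ⊗[k] (H ⊗[k] H) :=
    Algebra.TensorProduct.map (AlgHom.id k H) (epsTwo k H)
  have hA : m.comp (Algebra.TensorProduct.map (AlgHom.id k H)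
      (Algebra.TensorProduct.map (AlgHom.id k H) Δ)) = AlgHom.id k _ := by
    ext x
    · simp [m]
    · simp [m, epsTwo]
    · have := counit_left (k := k) x
      simp [m, epsTwo, this]
  have hB (z : H ⊗[k] (H ⊗[k] H)) : m (Algebra.TensorProduct.assoc k k k H H (H ⊗[k] H)
          (Algebra.TensorProduct.map Δ (AlgHom.id k (H ⊗[k] H)) z)) =
        Algebra.TensorProduct.assoc k k k H H H
          (Algebra.TensorProduct.map Δ (AlgHom.id k H) (epsTwo k H z)) := by
    have aux (D : H ⊗[k] H) (q r : H) :
        m (Algebra.TensorProduct.assoc k k k H H (H ⊗[k] H) (D ⊗ₜ (q ⊗ₜ r))) =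
          Algebra.TensorProduct.assoc k k k H H H (D ⊗ₜ (ε (k := k) q • r)) := by
      induction D using TensorProduct.induction_on with
      | zero => simp
      | add x y hx hy => simp only [TensorProduct.add_tmul, map_add, hx, hy]
      | tmul a b => simp [m, epsTwo]
    induction z using TensorProduct.induction_on with
    | zero => simp
    | add x y hx hy => simp only [map_add, hx, hy]
    | tmul p z =>
      induction z using TensorProduct.induction_on with
      | zero => simp
      | add x y hx hy => simp only [TensorProduct.tmul_add, map_add, hx, hy]
      | tmul q r =>
        refine (aux (Δ p) q r).trans ?_
        simp [epsTwo]
  have hD : m.comp (Algebra.TensorProduct.map (AlgHom.id k H)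
          ((Algebra.TensorProduct.assoc k k k H H H).toAlgHom.comp
            (Algebra.TensorProduct.map Δ (AlgHom.id k H)))) = AlgHom.id k _ := by
    have aux (D : H ⊗[k] H) (r : H) :
        epsTwo k H (Algebra.TensorProduct.assoc k k k H H H (D ⊗ₜ r)) =
          (Algebra.TensorProduct.rid k k H
            (Algebra.TensorProduct.map (AlgHom.id k H) (ε (k := k)) D)) ⊗ₜ r := by
      induction D using TensorProduct.induction_on with
      | zero => simp
      | add x y hx hy => simp only [TensorProduct.add_tmul, map_add, hx, hy]
      | tmul a b => simp [epsTwo, TensorProduct.smul_tmul]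
    apply Algebra.TensorProduct.ext'
    intro x z
    have h : ∀ z : H ⊗[k] H, epsTwo k H (Algebra.TensorProduct.assoc k k k H H H
        (Algebra.TensorProduct.map Δ (AlgHom.id k H) z)) = z := by
      intro z
      induction z using TensorProduct.induction_on with
      | zero => simp
      | add x y hx hy => simp only [map_add, hx, hy]
      | tmul y z => exact (aux (Δ y) z).trans (by rw [counit_right])
    exact congrArg (fun t => x ⊗ₜ[k] t) (h z)
  have hE (z : H ⊗[k] (H ⊗[k] H)) : m (Algebra.TensorProduct.map (AlgHom.id k H)
          (Algebra.TensorProduct.map (AlgHom.id k H) Algebra.TensorProduct.includeLeft) z) =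
        Algebra.TensorProduct.map (AlgHom.id k H) Algebra.TensorProduct.includeLeft
          (epsThree k H z) := by
    induction z using TensorProduct.induction_on with
    | zero => simp
    | add x y hx hy => simp only [map_add, hx, hy]
    | tmul p z =>
      induction z using TensorProduct.induction_on with
      | zero => simp
      | add x y hx hy => simp only [TensorProduct.tmul_add, map_add, hx, hy]
      | tmul q r => simp [m, epsTwo, epsThree]
  have h2 : epsTwo k H φ.val = 1 := counit_mid
  have hC : m ((1 : H) ⊗ₜ[k] φ.val) = 1 := by
    change (1 : H) ⊗ₜ[k] epsTwo k H φ.val = 1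
    rw [h2]; rfl
  have h := congrArg m (pentagon (k := k) (H := H))
  rw [map_mul, map_mul, map_mul, hB, hE, hC, h2, map_one, map_one, mul_one, one_mul] at h
  have h3 := DFunLike.congr_fun hA φ.val
  have h4 := DFunLike.congr_fun hD φ.val
  simp only [AlgHom.comp_apply] at h3 h4
  rw [h3, h4] at h
  have h5 : Algebra.TensorProduct.map (AlgHom.id k H) Algebra.TensorProduct.includeLeft
      (epsThree k H φ.val) = (1 : H ⊗[k] (H ⊗[k] H)) := by
    have := congrArg (fun t => φ.inv * t) h
    simp only [← mul_assoc, AlgHom.id_apply] at this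
    rw [φ.inv_val, one_mul] at this
    exact this.symm
  have h6 := congrArg (epsThree k H) h5
  have h7 (z : H ⊗[k] H) : epsThree k H (Algebra.TensorProduct.map (AlgHom.id k H)
      Algebra.TensorProduct.includeLeft z) = z := by
    induction z using TensorProduct.induction_on with
    | zero => simp
    | add x y hx hy => simp only [map_add, hx, hy]
    | tmul q r => simp [epsThree]
  rw [h7, map_one] at h6
  exact h6

end Counit
/-- `x ⊗ y ⊗ z ↦ x ⊗ y b S(z)` -/
noncomputable def kap (S : H ≃ₐ[k] Hᵐᵒᵖ) (b : H) : H ⊗[k] (H ⊗[k] H) →ₗ[k] H ⊗[k] H :=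
  TensorProduct.map LinearMap.id (sandRight S b)

/-- `x ⊗ y ⊗ z ↦ x ⊗ S(y) a z` -/
noncomputable def lam (S : H ≃ₐ[k] Hᵐᵒᵖ) (a : H) : H ⊗[k] (H ⊗[k] H) →ₗ[k] H ⊗[k] H :=
  TensorProduct.map LinearMap.id (sandLeft S a)

theorem kap_tmul (S : H ≃ₐ[k] Hᵐᵒᵖ) (b x y z : H) :
    kap S b (x ⊗ₜ (y ⊗ₜ z)) = x ⊗ₜ (y * b * antiMap S z) := rfl

theorem lam_tmul (S : H ≃ₐ[k] Hᵐᵒᵖ) (a x y z : H) :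
    lam S a (x ⊗ₜ (y ⊗ₜ z)) = x ⊗ₜ (antiMap S y * a * z) := rfl

theorem sandLeft_smul (S : H ≃ₐ[k] Hᵐᵒᵖ) (e : k) (a : H) (z : H ⊗[k] H) :
    sandLeft S (e • a) z = e • sandLeft S a z := by
  induction z using TensorProduct.induction_on with
  | zero => simp
  | add x y hx hy => simp only [map_add, hx, hy, smul_add]
  | tmul x y => simp [sandLeft_tmul]

theorem sandRight_smul (S : H ≃ₐ[k] Hᵐᵒᵖ) (e : k) (a : H) (z : H ⊗[k] H) :
    sandRight S (e • a) z = e • sandRight S a z := by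
  induction z using TensorProduct.induction_on with
  | zero => simp
  | add x y hx hy => simp only [map_add, hx, hy, smul_add]
  | tmul x y => simp [sandRight_tmul]

theorem kap_smul (S : H ≃ₐ[k] Hᵐᵒᵖ) (e : k) (b : H) (z : H ⊗[k] (H ⊗[k] H)) :
    kap S (e • b) z = e • kap S b z := by
  induction z using TensorProduct.induction_on with
  | zero => simp
  | add x y hx hy => simp only [map_add, hx, hy, smul_add]
  | tmul x y => simp [kap, sandRight_smul]

theorem lam_smul (S : H ≃ₐ[k] Hᵐᵒᵖ) (e : k) (b : H) (z : H ⊗[k] (H ⊗[k] H)) :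
    lam S (e • b) z = e • lam S b z := by
  induction z using TensorProduct.induction_on with
  | zero => simp
  | add x y hx hy => simp only [map_add, hx, hy, smul_add]
  | tmul x y => simp [lam, sandLeft_smul]

theorem zigzag_smul (S : H ≃ₐ[k] Hᵐᵒᵖ) (e d : k) (a b : H) (z : H ⊗[k] (H ⊗[k] H)) :
    zigzag S (e • a) (d • b) z = (d * e) • zigzag S a b z := by
  induction z using TensorProduct.induction_on with
  | zero => simp
  | add x y hx hy => simp only [map_add, hx, hy, smul_add]
  | tmul x y => simp [zigzag, sandLeft_smul, smul_smul, mul_comm]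

theorem zagzig_smul (S : H ≃ₐ[k] Hᵐᵒᵖ) (e d : k) (a b : H) (z : H ⊗[k] (H ⊗[k] H)) :
    zagzig S (e • a) (d • b) z = (d * e) • zagzig S a b z := by
  induction z using TensorProduct.induction_on with
  | zero => simp
  | add x y hx hy => simp only [map_add, hx, hy, smul_add]
  | tmul x y => simp [zagzig, sandRight_smul, smul_smul, mul_comm]

/-- Induction on pure tensors in three factors. -/
theorem pure3 {p : H ⊗[k] (H ⊗[k] H) → Prop} (zero : p 0) (add : ∀ x y, p x → p y → p (x + y))
    (tmul : ∀ x y z, p (x ⊗ₜ (y ⊗ₜ z))) (z : H ⊗[k] (H ⊗[k] H)) : p z := by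
  induction z using TensorProduct.induction_on with
  | zero => exact zero
  | add x y hx hy => exact add x y hx hy
  | tmul x z =>
    induction z using TensorProduct.induction_on with
    | zero => simpa using zero
    | add y z hy hz => simpa only [TensorProduct.tmul_add] using add _ _ hy hz
    | tmul y z => exact tmul x y z

theorem kap_mul_right (S : H ≃ₐ[k] Hᵐᵒᵖ) (b x : H) (P : H ⊗[k] (H ⊗[k] H)) (E : H ⊗[k] H) :
    kap S b (P * x ⊗ₜ E) = kap S (sandRight S b E) P * x ⊗ₜ 1 := by
  induction P using pure3 with
  | zero => simp
  | add P Q hP hQ => simp only [add_mul, map_add, hP, hQ]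
  | tmul p q r =>
    induction E using TensorProduct.induction_on with
    | zero => simp [kap, sandRight]
    | add y z hy hz =>
      rw [TensorProduct.tmul_add, mul_add, map_add, hy, hz]
      simp only [map_add, kap_tmul, mul_add, add_mul, TensorProduct.tmul_add,
        Algebra.TensorProduct.tmul_mul_tmul]
    | tmul y z =>
      simp only [kap_tmul, Algebra.TensorProduct.tmul_mul_tmul, sandRight_tmul, antiMap_mul,
        mul_one, mul_assoc]

theorem kap_mul_left (S : H ≃ₐ[k] Hᵐᵒᵖ) (b y : H) (P : H ⊗[k] (H ⊗[k] H)) (D : H ⊗[k] H) :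
    kap S b (Algebra.TensorProduct.assoc k k k H H H (D ⊗ₜ y) * P) =
      D * kap S b P * 1 ⊗ₜ antiMap S y := by
  induction P using pure3 with
  | zero => simp
  | add P Q hP hQ => simp only [mul_add, add_mul, map_add, hP, hQ]
  | tmul p q r =>
    induction D using TensorProduct.induction_on with
    | zero => simp
    | add y z hy hz => simp only [TensorProduct.add_tmul, add_mul, map_add, hy, hz]
    | tmul x z =>
      simp only [kap_tmul, Algebra.TensorProduct.tmul_mul_tmul, antiMap_mul,
        Algebra.TensorProduct.assoc_tmul, mul_one, mul_assoc]

theorem lam_mul_left (S : H ≃ₐ[k] Hᵐᵒᵖ) (a x : H) (P : H ⊗[k] (H ⊗[k] H)) (E : H ⊗[k] H) :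
    lam S a (x ⊗ₜ E * P) = x ⊗ₜ 1 * lam S (sandLeft S a E) P := by
  induction P using pure3 with
  | zero => simp
  | add P Q hP hQ => simp only [mul_add, map_add, hP, hQ]
  | tmul p q r =>
    induction E using TensorProduct.induction_on with
    | zero => simp [lam, sandLeft]
    | add y z hy hz =>
      rw [TensorProduct.tmul_add, add_mul, map_add, hy, hz]
      simp only [map_add, lam_tmul, mul_add, add_mul, TensorProduct.tmul_add,
        Algebra.TensorProduct.tmul_mul_tmul]
    | tmul y z =>
      simp only [lam_tmul, Algebra.TensorProduct.tmul_mul_tmul, sandLeft_tmul, antiMap_mul,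
        one_mul, mul_assoc]

theorem zigzag_mul (S : H ≃ₐ[k] Hᵐᵒᵖ) (a b q z : H) (D E : H ⊗[k] H)
    (Q : H ⊗[k] (H ⊗[k] H)) :
    zigzag S a b (q ⊗ₜ D * Q * Algebra.TensorProduct.assoc k k k H H H (E ⊗ₜ z)) =
      q * zigzag S (sandLeft S a D) (sandRight S b E) Q * z := by
  induction Q using pure3 with
  | zero => simp
  | add P Q hP hQ => simp only [mul_add, add_mul, map_add, hP, hQ]
  | tmul u v w =>
    induction D using TensorProduct.induction_on with
    | zero => simp [zigzag_tmul]
    | add y z hy hz =>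
      rw [TensorProduct.tmul_add, add_mul, add_mul, map_add, hy, hz]
      simp only [map_add, zigzag_tmul, mul_add, add_mul]
    | tmul d d' =>
      induction E using TensorProduct.induction_on with
      | zero => simp [zigzag_tmul]
      | add y z hy hz =>
        rw [TensorProduct.add_tmul, map_add, mul_add, map_add, hy, hz]
        simp only [map_add, zigzag_tmul, mul_add, add_mul]
      | tmul e e' =>
        simp only [Algebra.TensorProduct.tmul_mul_tmul, Algebra.TensorProduct.assoc_tmul,
          zigzag_tmul, sandLeft_tmul, sandRight_tmul, antiMap_mul, mul_assoc]

theorem zagzig_mul (S : H ≃ₐ[k] Hᵐᵒᵖ) (a b q z : H) (D E : H ⊗[k] H)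
    (Q : H ⊗[k] (H ⊗[k] H)) :
    zagzig S a b (Algebra.TensorProduct.assoc k k k H H H (E ⊗ₜ z) * Q * q ⊗ₜ D) =
      antiMap S q * zagzig S (sandLeft S a E) (sandRight S b D) Q * antiMap S z := by
  induction Q using pure3 with
  | zero => simp
  | add P Q hP hQ => simp only [mul_add, add_mul, map_add, hP, hQ]
  | tmul u v w =>
    induction D using TensorProduct.induction_on with
    | zero => simp [zagzig_tmul]
    | add y z hy hz =>
      rw [TensorProduct.tmul_add, mul_add, map_add, hy, hz]
      simp only [map_add, zagzig_tmul, mul_add, add_mul]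
    | tmul d d' =>
      induction E using TensorProduct.induction_on with
      | zero => simp [zagzig_tmul]
      | add y z hy hz =>
        rw [TensorProduct.add_tmul, map_add, add_mul, add_mul, map_add, hy, hz]
        simp only [map_add, zagzig_tmul, mul_add, add_mul]
      | tmul e e' =>
        simp only [Algebra.TensorProduct.tmul_mul_tmul, Algebra.TensorProduct.assoc_tmul,
          zagzig_tmul, sandLeft_tmul, sandRight_tmul, antiMap_mul, mul_assoc]

end Contraction


section Contraction2

open QuasiBialgebra QuasiHopfAlgebra Algebra.TensorProduct

variable {k : Type u} {H : Type w} [CommRing k] [Ring H] [Algebra k H] [QuasiHopfAlgebra k H]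

section
variable {k : Type u} {H : Type w} [CommRing k] [Ring H] [Algebra k H]

theorem mul_add4 (x y z : H ⊗[k] (H ⊗[k] (H ⊗[k] H))) : x * (y + z) = x * y + x * z :=
  Distrib.left_distrib x y z

theorem mul_zero4 (x : H ⊗[k] (H ⊗[k] (H ⊗[k] H))) : x * 0 = 0 :=
  MulZeroClass.mul_zero x

theorem tmul_mul_tmul4 (a b : H) (x y : H ⊗[k] (H ⊗[k] H)) :
    a ⊗ₜ[k] x * b ⊗ₜ[k] y = (a * b) ⊗ₜ[k] (x * y) :=
  Algebra.TensorProduct.tmul_mul_tmul a b x y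

end

variable (k H) in
/-- `φ⁻¹ ⊗ φ⁻² β S(φ⁻³)` -/
noncomputable def curryElt : H ⊗[k] H := kap (S (k := k)) (β (k := k)) φ.inv

variable (k H) in
/-- `φ¹ ⊗ S(φ²) α φ³` -/
noncomputable def evElt : H ⊗[k] H := lam (S (k := k)) (α (k := k)) φ.val

theorem kap_coassoc (h : H) :
    kap (S (k := k)) (β (k := k)) (Algebra.TensorProduct.assoc k k k H H H
      (Algebra.TensorProduct.map Δ (AlgHom.id k H) (Δ h)) * φ.inv) =
      curryElt k H * h ⊗ₜ 1 := by
  have h1 : Algebra.TensorProduct.assoc k k k H H H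
      (Algebra.TensorProduct.map Δ (AlgHom.id k H) (Δ h)) * φ.inv =
      φ.inv * Algebra.TensorProduct.map (AlgHom.id k H) Δ (Δ (k := k) h) := by
    have h0 := congrArg (fun t => φ.inv * t * φ.inv) (coassoc (k := k) h)
    simp only [mul_assoc] at h0
    rw [φ.val_inv, mul_one, ← mul_assoc φ.inv φ.val, φ.inv_val, one_mul] at h0
    exact h0.symm
  have h2 (D : H ⊗[k] H) : kap (S (k := k)) (β (k := k))
      (φ.inv * Algebra.TensorProduct.map (AlgHom.id k H) Δ D) =
      curryElt k H * (Algebra.TensorProduct.rid k k H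
        (Algebra.TensorProduct.map (AlgHom.id k H) ε D)) ⊗ₜ 1 := by
    induction D using TensorProduct.induction_on with
    | zero => simp
    | add x y hx hy => simp only [map_add, mul_add, TensorProduct.add_tmul, hx, hy]
    | tmul x y =>
      rw [Algebra.TensorProduct.map_tmul, kap_mul_right, antipode_right, kap_smul]
      simp [curryElt, ← TensorProduct.smul_tmul']
  rw [h1, h2, counit_right]

theorem lam_coassoc (h : H) :
    lam (S (k := k)) (α (k := k)) (φ.val * Algebra.TensorProduct.assoc k k k H H H
      (Algebra.TensorProduct.map Δ (AlgHom.id k H) (Δ h))) =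
      h ⊗ₜ 1 * evElt k H := by
  have h2 (D : H ⊗[k] H) : lam (S (k := k)) (α (k := k))
      (Algebra.TensorProduct.map (AlgHom.id k H) Δ D * φ.val) =
      (Algebra.TensorProduct.rid k k H
        (Algebra.TensorProduct.map (AlgHom.id k H) ε D)) ⊗ₜ 1 * evElt k H := by
    induction D using TensorProduct.induction_on with
    | zero => simp
    | add x y hx hy => simp only [map_add, add_mul, TensorProduct.add_tmul, hx, hy]
    | tmul x y =>
      rw [Algebra.TensorProduct.map_tmul, lam_mul_left, antipode_left, lam_smul]
      simp [evElt, ← TensorProduct.smul_tmul']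
  rw [← coassoc, h2, counit_right]

/-- `x ⊗ y ↦ Δ(x) Q (1 ⊗ y)` -/
noncomputable def psi (Q : H ⊗[k] H) : H ⊗[k] H →ₗ[k] H ⊗[k] H :=
  TensorProduct.lift (LinearMap.mk₂ k (fun x y => Δ x * Q * 1 ⊗ₜ y)
    (fun x x' y => by simp only [map_add, add_mul])
    (fun c x y => by simp)
    (fun x y y' => by simp only [TensorProduct.tmul_add, mul_add])
    (fun c x y => by simp))

theorem psi_tmul (Q : H ⊗[k] H) (x y : H) : psi Q (x ⊗ₜ y) = Δ x * Q * 1 ⊗ₜ y := rfl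

theorem e3_inv : epsThree k H φ.inv = 1 := by
  have h : epsThree k H (φ.inv * φ.val) = 1 := by rw [φ.inv_val, map_one]
  rwa [map_mul, epsThree_φ, mul_one] at h

theorem e2_inv : epsTwo k H φ.inv = 1 := by
  have h : epsTwo k H (φ.inv * φ.val) = 1 := by rw [φ.inv_val, map_one]
  have h2 : epsTwo k H φ.val = 1 := counit_mid
  rwa [map_mul, h2, mul_one] at h

theorem counit_mid' : epsTwo k H φ.val = 1 := counit_mid

theorem zigzag_pentagon (P Q X : H ⊗[k] (H ⊗[k] H)) :
    TensorProduct.map LinearMap.id (zigzag (S (k := k)) (α (k := k)) (β (k := k)))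
      (Algebra.TensorProduct.map (AlgHom.id k H)
          (Algebra.TensorProduct.map (AlgHom.id k H) Δ) P *
        ((1 : H) ⊗ₜ[k] Q *
        Algebra.TensorProduct.map (AlgHom.id k H)
          ((Algebra.TensorProduct.assoc k k k H H H).toAlgHom.comp
            (Algebra.TensorProduct.map Δ (AlgHom.id k H))) X)) =
      epsThree k H P * 1 ⊗ₜ zigzag (S (k := k)) (α (k := k)) (β (k := k)) Q * epsTwo k H X := by
  induction P using pure3 with
  | zero => simp
  | add x y hx hy => simp only [map_add, add_mul, hx, hy]
  | tmul p q r =>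
    induction X using pure3 with
    | zero => simp [mul_zero4]
    | add x y hx hy => simp only [map_add, mul_add4, mul_add, hx, hy]
    | tmul x y z =>
      have h : zigzag (S (k := k)) (α (k := k)) (β (k := k)) (q ⊗ₜ Δ r *
          (Q * Algebra.TensorProduct.assoc k k k H H H (Δ y ⊗ₜ z))) =
          ε (k := k) r • q * zigzag (S (k := k)) (α (k := k)) (β (k := k)) Q *
            ε (k := k) y • z := by
        rw [← mul_assoc, zigzag_mul, antipode_left, antipode_right, zigzag_smul]
        simp [smul_smul, mul_comm]
      have h' : (Algebra.TensorProduct.map (AlgHom.id k H)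
          (Algebra.TensorProduct.map (AlgHom.id k H) Δ) (p ⊗ₜ (q ⊗ₜ r)) *
        ((1 : H) ⊗ₜ[k] Q *
        Algebra.TensorProduct.map (AlgHom.id k H)
          ((Algebra.TensorProduct.assoc k k k H H H).toAlgHom.comp
            (Algebra.TensorProduct.map Δ (AlgHom.id k H))) (x ⊗ₜ (y ⊗ₜ z)))) =
          (p * (1 * x)) ⊗ₜ[k] (q ⊗ₜ Δ r *
          (Q * Algebra.TensorProduct.assoc k k k H H H (Δ y ⊗ₜ z))) := by
        rw [Algebra.TensorProduct.map_tmul, Algebra.TensorProduct.map_tmul,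
          Algebra.TensorProduct.map_tmul, tmul_mul_tmul4, tmul_mul_tmul4]
        rfl
      rw [h', TensorProduct.map_tmul, h]
      simp [epsThree, epsTwo]

theorem zagzig_pentagon (P Q X : H ⊗[k] (H ⊗[k] H))
    (hQ : zagzig (S (k := k)) (α (k := k)) (β (k := k)) Q = 1) :
    TensorProduct.map LinearMap.id (zagzig (S (k := k)) (α (k := k)) (β (k := k)))
      (Algebra.TensorProduct.map (AlgHom.id k H)
          ((Algebra.TensorProduct.assoc k k k H H H).toAlgHom.comp
            (Algebra.TensorProduct.map Δ (AlgHom.id k H))) X *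
        ((1 : H) ⊗ₜ[k] Q *
        Algebra.TensorProduct.map (AlgHom.id k H)
          (Algebra.TensorProduct.map (AlgHom.id k H) Δ) P)) =
      TensorProduct.map LinearMap.id (antiMap (S (k := k))) (epsTwo k H X * epsThree k H P) := by
  induction P using pure3 with
  | zero => simp [mul_zero4]
  | add x y hx hy => simp only [map_add, mul_add4, mul_add, hx, hy]
  | tmul p q r =>
    induction X using pure3 with
    | zero => simp
    | add x y hx hy => simp only [map_add, add_mul, hx, hy]
    | tmul x y z =>
      have h : zagzig (S (k := k)) (α (k := k)) (β (k := k))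
          (Algebra.TensorProduct.assoc k k k H H H (Δ y ⊗ₜ z) * (Q * q ⊗ₜ Δ r)) =
          antiMap (S (k := k)) (ε (k := k) y • z * ε (k := k) r • q) := by
        rw [← mul_assoc, zagzig_mul, antipode_left, antipode_right, zagzig_smul, hQ]
        simp [smul_smul, antiMap_mul]
      have h' : (Algebra.TensorProduct.map (AlgHom.id k H)
          ((Algebra.TensorProduct.assoc k k k H H H).toAlgHom.comp
            (Algebra.TensorProduct.map Δ (AlgHom.id k H))) (x ⊗ₜ (y ⊗ₜ z)) *
        ((1 : H) ⊗ₜ[k] Q * Algebra.TensorProduct.map (AlgHom.id k H)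
          (Algebra.TensorProduct.map (AlgHom.id k H) Δ) (p ⊗ₜ (q ⊗ₜ r)))) =
          (x * (1 * p)) ⊗ₜ[k] (Algebra.TensorProduct.assoc k k k H H H (Δ y ⊗ₜ z) *
            (Q * q ⊗ₜ Δ r)) := by
        rw [Algebra.TensorProduct.map_tmul, Algebra.TensorProduct.map_tmul,
          Algebra.TensorProduct.map_tmul, tmul_mul_tmul4, tmul_mul_tmul4]
        rfl
      rw [h', TensorProduct.map_tmul, h]
      simp [epsThree, epsTwo]

theorem psi_lam (P Q : H ⊗[k] (H ⊗[k] H)) :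
    psi (kap (S (k := k)) (β (k := k)) Q) (lam (S (k := k)) (α (k := k)) P) =
      TensorProduct.map LinearMap.id (zigzag (S (k := k)) (α (k := k)) (β (k := k)))
        (Algebra.TensorProduct.assoc k k k H H (H ⊗[k] H)
            (Algebra.TensorProduct.map Δ (AlgHom.id k (H ⊗[k] H)) P) *
          Algebra.TensorProduct.map (AlgHom.id k H)
            (Algebra.TensorProduct.map (AlgHom.id k H) Algebra.TensorProduct.includeLeft) Q) := by
  have aux (E : H ⊗[k] H) (q r x y z : H) :
      E * kap (S (k := k)) (β (k := k)) (x ⊗ₜ (y ⊗ₜ z)) * 1 ⊗ₜ (antiMap (S (k := k)) q * α (k := k) * r) =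
      TensorProduct.map LinearMap.id (zigzag (S (k := k)) (α (k := k)) (β (k := k)))
        (Algebra.TensorProduct.assoc k k k H H (H ⊗[k] H) (E ⊗ₜ (q ⊗ₜ r)) *
          x ⊗ₜ (y ⊗ₜ (z ⊗ₜ 1))) := by
    induction E using TensorProduct.induction_on with
    | zero => simp
    | add a b ha hb => simp only [add_mul, TensorProduct.add_tmul, map_add, ha, hb]
    | tmul a b =>
      simp only [kap_tmul, Algebra.TensorProduct.tmul_mul_tmul, Algebra.TensorProduct.assoc_tmul,
        TensorProduct.map_tmul, zigzag_tmul, LinearMap.id_apply, antiMap_mul, mul_one, mul_assoc]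
  induction P using pure3 with
  | zero => simp
  | add x y hx hy => simp only [map_add, add_mul, hx, hy]
  | tmul p q r =>
    induction Q using pure3 with
    | zero => simp [lam_tmul, psi_tmul]
    | add x y hx hy =>
      simp only [lam_tmul, psi_tmul, map_add, mul_add, add_mul] at hx hy ⊢
      simp only [hx, hy]
    | tmul x y z =>
      rw [lam_tmul, psi_tmul]
      exact aux (Δ p) q r x y z

theorem lam_kap (P Q : H ⊗[k] (H ⊗[k] H)) :
    lam (S (k := k)) (α (k := k)) (P * Algebra.TensorProduct.assoc k k k H H H
        (Algebra.TensorProduct.map Δ (AlgHom.id k H) (kap (S (k := k)) (β (k := k)) Q))) =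
      TensorProduct.map LinearMap.id (zagzig (S (k := k)) (α (k := k)) (β (k := k)))
        (Algebra.TensorProduct.map (AlgHom.id k H)
            (Algebra.TensorProduct.map (AlgHom.id k H) Algebra.TensorProduct.includeLeft) P *
          Algebra.TensorProduct.assoc k k k H H (H ⊗[k] H)
            (Algebra.TensorProduct.map Δ (AlgHom.id k (H ⊗[k] H)) Q)) := by
  have aux (E : H ⊗[k] H) (p q r y z : H) :
      lam (S (k := k)) (α (k := k)) (p ⊗ₜ (q ⊗ₜ r) * Algebra.TensorProduct.assoc k k k H H H
        (E ⊗ₜ (y * β (k := k) * antiMap (S (k := k)) z))) =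
      TensorProduct.map LinearMap.id (zagzig (S (k := k)) (α (k := k)) (β (k := k)))
        (p ⊗ₜ (q ⊗ₜ (r ⊗ₜ 1)) *
          Algebra.TensorProduct.assoc k k k H H (H ⊗[k] H) (E ⊗ₜ (y ⊗ₜ z))) := by
    induction E using TensorProduct.induction_on with
    | zero => simp [mul_zero4]
    | add a b ha hb => simp only [mul_add4, mul_add, TensorProduct.add_tmul, map_add, ha, hb]
    | tmul a b =>
      simp only [lam_tmul, Algebra.TensorProduct.tmul_mul_tmul, Algebra.TensorProduct.assoc_tmul,
        TensorProduct.map_tmul, zagzig_tmul, LinearMap.id_apply, antiMap_mul, one_mul, mul_assoc]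
  induction P using pure3 with
  | zero => simp
  | add x y hx hy => simp only [map_add, add_mul, hx, hy]
  | tmul p q r =>
    induction Q using pure3 with
    | zero => simp
    | add x y hx hy => simp only [map_add, mul_add, hx, hy]
    | tmul x y z => exact aux (Δ x) p q r y z

theorem pentagon_rearr1 {M : Type*} [Monoid M] {A A' B C D E E' : M} (h : A * B = C * D * E)
    (hA : A' * A = 1) (hE : E * E' = 1) : B * E' = A' * (C * D) := by
  have h1 : A' * (A * B) * E' = A' * (C * D * E) * E' := by rw [h]
  rw [← mul_assoc, hA, one_mul, mul_assoc A', mul_assoc _ E, hE, mul_one] at h1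
  exact h1

theorem pentagon_rearr2 {M : Type*} [Monoid M] {A B B' C C' D D' E : M} (h : A * B = C * D * E)
    (hB : B * B' = 1) (hC : C' * C = 1) (hD : D' * D = 1) : E * B' = D' * (C' * A) := by
  have h1 : D' * (C' * (A * B * B')) = D' * (C' * (C * D * E * B')) := by rw [h]
  rw [mul_assoc A, hB, mul_one] at h1
  rw [h1]
  simp only [mul_assoc]
  rw [← mul_assoc C', hC, one_mul, ← mul_assoc D', hD, one_mul]

theorem hom_val_inv {A B : Type*} [Semiring A] [Semiring B] [Algebra k A] [Algebra k B]
    (f : A →ₐ[k] B) (u : Aˣ) : f u.val * f u.inv = 1 := by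
  rw [← map_mul, u.val_inv, map_one]

theorem hom_inv_val {A B : Type*} [Semiring A] [Semiring B] [Algebra k A] [Algebra k B]
    (f : A →ₐ[k] B) (u : Aˣ) : f u.inv * f u.val = 1 := by
  rw [← map_mul, u.inv_val, map_one]

theorem psi_evElt : psi (curryElt k H) (evElt k H) = 1 := by
  have h := pentagon_rearr1 (pentagon (k := k) (H := H))
    (hom_inv_val (Algebra.TensorProduct.map (AlgHom.id k H)
      (Algebra.TensorProduct.map (AlgHom.id k H) Δ)) φ)
    (hom_val_inv (Algebra.TensorProduct.map (AlgHom.id k H)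
      (Algebra.TensorProduct.map (AlgHom.id k H) Algebra.TensorProduct.includeLeft)) φ)
  rw [curryElt, evElt, psi_lam]
  refine (congrArg _ h).trans ?_
  refine (zigzag_pentagon φ.inv φ.val φ.val).trans ?_
  rw [e3_inv, zigzag_φ, counit_mid']
  simp [Algebra.TensorProduct.one_def]

theorem lam_curryElt : lam (S (k := k)) (α (k := k)) (φ.val *
    Algebra.TensorProduct.assoc k k k H H H
      (Algebra.TensorProduct.map Δ (AlgHom.id k H) (curryElt k H))) = 1 := by
  have h := pentagon_rearr2 (pentagon (k := k) (H := H))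
    (hom_val_inv ((Algebra.TensorProduct.assoc k k k H H (H ⊗[k] H)).toAlgHom.comp
      (Algebra.TensorProduct.map Δ (AlgHom.id k (H ⊗[k] H)))) φ)
    (hom_inv_val (Algebra.TensorProduct.includeRight (R := k) (A := H)) φ)
    (hom_inv_val (Algebra.TensorProduct.map (AlgHom.id k H)
          ((Algebra.TensorProduct.assoc k k k H H H).toAlgHom.comp
            (Algebra.TensorProduct.map Δ (AlgHom.id k H)))) φ)
  rw [curryElt, lam_kap]
  refine (congrArg _ h).trans ?_
  refine (zagzig_pentagon φ.val φ.inv φ.inv zagzig_φ_inv).trans ?_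
  rw [e2_inv, epsThree_φ, mul_one]
  simp [Algebra.TensorProduct.one_def, antiMap_one]

end Contraction2


namespace HRep

open QuasiBialgebra QuasiHopfAlgebra TAct

section

variable {k : Type u} {H : Type w} [CommRing k] [Ring H] [Algebra k H]
  {U V W : Type u} [AddCommGroup U] [Module k U] [AddCommGroup V] [Module k V]
  [AddCommGroup W] [Module k W]

/-- `h` acts on `L` by `h ∘ L`. -/
def postAct (σ : H →ₐ[k] Module.End k W) : H →ₐ[k] Module.End k (V →ₗ[k] W) where
  toFun h := (σ h).compRight k
  map_one' := by ext; simp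
  map_mul' x y := by ext; simp
  map_zero' := by ext; simp
  map_add' x y := by ext; simp
  commutes' c := by ext; simp [Module.algebraMap_end_apply]

/-- `h` acts on `L` by `L ∘ S(h)`. -/
def preAct (S : H ≃ₐ[k] Hᵐᵒᵖ) (ρ : H →ₐ[k] Module.End k V) :
    H →ₐ[k] Module.End k (V →ₗ[k] W) where
  toFun h := LinearMap.lcomp k W (ρ (antiMap S h))
  map_one' := by ext; simp [antiMap_one]
  map_mul' x y := by ext; simp [antiMap_mul]
  map_zero' := by ext; simp
  map_add' x y := by ext; simp
  commutes' c := by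
    ext L v
    have : antiMap S (algebraMap k H c) = algebraMap k H c := by
      rw [Algebra.algebraMap_eq_smul_one, map_smul, antiMap_one]
    simp [this, Module.algebraMap_end_apply]

/-- `(x ⊗ y) L = x ∘ L ∘ S(y)`. -/
noncomputable def homAct (S : H ≃ₐ[k] Hᵐᵒᵖ) (ρ : H →ₐ[k] Module.End k V)
    (σ : H →ₐ[k] Module.End k W) : H ⊗[k] H →ₐ[k] Module.End k (V →ₗ[k] W) :=
  Algebra.TensorProduct.lift (postAct σ) (preAct S ρ) (fun x y => by
    ext L v
    rfl)

theorem homAct_tmul (S : H ≃ₐ[k] Hᵐᵒᵖ) (ρ : H →ₐ[k] Module.End k V)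
    (σ : H →ₐ[k] Module.End k W) (x y : H) (L : V →ₗ[k] W) :
    homAct S ρ σ (x ⊗ₜ y) L = σ x ∘ₗ L ∘ₗ ρ (antiMap S y) :=
  LinearMap.congr_fun (Algebra.TensorProduct.lift_tmul (postAct σ) (preAct S ρ) _ x y) L

/-- `(x ⊗ y) (L ⊗ v) = x L(y v)`. -/
noncomputable def evAct (ρ : H →ₐ[k] Module.End k V) (σ : H →ₐ[k] Module.End k W) :
    H ⊗[k] H →ₗ[k] (V →ₗ[k] W) ⊗[k] V →ₗ[k] W :=
  TensorProduct.lift (LinearMap.mk₂ k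
    (fun x y => σ x ∘ₗ TensorProduct.lift LinearMap.id ∘ₗ TensorProduct.map LinearMap.id (ρ y))
    (fun x x' y => by ext; simp)
    (fun c x y => by ext; simp)
    (fun x y y' => by ext; simp)
    (fun c x y => by ext; simp))

theorem evAct_tmul (ρ : H →ₐ[k] Module.End k V) (σ : H →ₐ[k] Module.End k W) (x y : H)
    (L : V →ₗ[k] W) (v : V) : evAct ρ σ (x ⊗ₜ y) (L ⊗ₜ v) = σ x (L (ρ y v)) := rfl

theorem evAct_mul_left (ρ : H →ₐ[k] Module.End k V) (σ : H →ₐ[k] Module.End k W) (x : H)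
    (z : H ⊗[k] H) (L : V →ₗ[k] W) (v : V) :
    evAct ρ σ (x ⊗ₜ 1 * z) (L ⊗ₜ v) = σ x (evAct ρ σ z (L ⊗ₜ v)) := by
  induction z using TensorProduct.induction_on with
  | zero => simp
  | add y z hy hz => simp only [mul_add, map_add, LinearMap.add_apply, hy, hz]
  | tmul y z =>
    rw [Algebra.TensorProduct.tmul_mul_tmul, evAct_tmul, evAct_tmul, one_mul, map_mul]
    rfl

theorem evAct_lam (S : H ≃ₐ[k] Hᵐᵒᵖ) (a : H) (ρ : H →ₐ[k] Module.End k V)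
    (σ : H →ₐ[k] Module.End k W) (P : H ⊗[k] (H ⊗[k] H)) (D : H ⊗[k] H) (y : H)
    (L : V →ₗ[k] W) (v : V) :
    evAct ρ σ (lam S a P) (homAct S ρ σ D L ⊗ₜ ρ y v) =
      evAct ρ σ (lam S a (P * Algebra.TensorProduct.assoc k k k H H H (D ⊗ₜ y))) (L ⊗ₜ v) := by
  induction P using pure3 with
  | zero => simp
  | add x z hx hz => simp only [add_mul, map_add, LinearMap.add_apply, hx, hz]
  | tmul p q r =>
    induction D using TensorProduct.induction_on with
    | zero => simp
    | add x z hx hz =>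
      simp only [TensorProduct.add_tmul, mul_add, map_add, LinearMap.add_apply, hx, hz]
    | tmul d e =>
      simp only [lam_tmul, evAct_tmul, homAct_tmul, Algebra.TensorProduct.assoc_tmul,
        Algebra.TensorProduct.tmul_mul_tmul, antiMap_mul, map_mul, LinearMap.comp_apply,
        Module.End.mul_apply]

end

variable {k : Type u} {H : Type w} [CommRing k] [Ring H] [Algebra k H] [QuasiHopfAlgebra k H]

/-- The internal hom `Hom_k(V, W)` with the adjoint action `h L = h₁ ∘ L ∘ S(h₂)`. -/
noncomputable abbrev homObj (V W : HRep k H) : HRep k H where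
  carrier := V →ₗ[k] W
  ρ := (homAct (S (k := k)) V.ρ W.ρ).comp Δ

/-- The evaluation `ev(L ⊗ v) = φ¹ L(S(φ²) α φ³ v)`. -/
noncomputable def evMap (V W : HRep k H) : homObj V W ⊗ V ⟶ W where
  lin := evAct V.ρ W.ρ (evElt k H)
  equivariant h := by
    apply TensorProduct.ext'
    intro L v
    have key (D : H ⊗[k] H) : evAct V.ρ W.ρ (evElt k H)
        (tact ((homAct (S (k := k)) V.ρ W.ρ).comp Δ) V.ρ D (L ⊗ₜ v)) =
        evAct V.ρ W.ρ (lam (S (k := k)) (α (k := k)) (φ.val *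
          Algebra.TensorProduct.assoc k k k H H H
            (Algebra.TensorProduct.map Δ (AlgHom.id k H) D))) (L ⊗ₜ v) := by
      induction D using TensorProduct.induction_on with
      | zero => simp
      | add x y hx hy => simp only [map_add, mul_add, LinearMap.add_apply, hx, hy]
      | tmul x y =>
        rw [tact_tmul]
        exact evAct_lam (S (k := k)) (α (k := k)) V.ρ W.ρ φ.val (Δ x) y L v
    refine (key (Δ h)).trans ?_
    rw [lam_coassoc]
    exact evAct_mul_left V.ρ W.ρ h (evElt k H) L v

/-- The currying map `ζ(f)(x)(v) = f(φ⁻¹ x ⊗ φ⁻² β S(φ⁻³) v)`. -/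
noncomputable def curryMap {X V W : HRep k H} (f : X ⊗ V ⟶ W) : X ⟶ homObj V W where
  lin := TensorProduct.curry (f.lin ∘ₗ tact X.ρ V.ρ (curryElt k H))
  equivariant h := by
    apply LinearMap.ext
    intro x
    apply LinearMap.ext
    intro v
    have key (D : H ⊗[k] H) : homAct (S (k := k)) V.ρ W.ρ D
        (TensorProduct.curry (f.lin ∘ₗ tact X.ρ V.ρ (curryElt k H)) x) v =
        f.lin (tact X.ρ V.ρ (kap (S (k := k)) (β (k := k))
          (Algebra.TensorProduct.assoc k k k H H H
            (Algebra.TensorProduct.map Δ (AlgHom.id k H) D) * φ.inv)) (x ⊗ₜ v)) := by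
      induction D using TensorProduct.induction_on with
      | zero => simp
      | add a b ha hb => simp only [map_add, add_mul, LinearMap.add_apply, ha, hb]
      | tmul a b =>
        rw [homAct_tmul, Algebra.TensorProduct.map_tmul]
        have h1 := kap_mul_left (S (k := k)) (β (k := k)) b φ.inv (Δ (k := k) a)
        refine Eq.trans ?_ (congrArg (fun t => f.lin (tact X.ρ V.ρ t (x ⊗ₜ v))) h1).symm
        change W.ρ a (f.lin (tact X.ρ V.ρ (curryElt k H)
          (x ⊗ₜ V.ρ (antiMap (S (k := k)) b) v))) =
          f.lin (tact X.ρ V.ρ (Δ a * curryElt k H * 1 ⊗ₜ antiMap (S (k := k)) b) (x ⊗ₜ v))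
        rw [← hom_apply f a, map_mul, map_mul, Module.End.mul_apply, Module.End.mul_apply,
          tact_tmul, map_one]
        rfl
    refine Eq.trans ?_ (key (Δ h)).symm
    rw [kap_coassoc, map_mul, Module.End.mul_apply, tact_tmul, map_one]
    rfl

noncomputable instance : RightInternalHom (HRep k H) where
  ihom := homObj
  ev := evMap
  curry := curryMap
  curry_ev {X V W} f := by
    ext : 1
    apply TensorProduct.ext'
    intro x v
    have key (z : H ⊗[k] H) : evAct V.ρ W.ρ z
        (TensorProduct.curry (f.lin ∘ₗ tact X.ρ V.ρ (curryElt k H)) x ⊗ₜ v) =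
        f.lin (tact X.ρ V.ρ (psi (curryElt k H) z) (x ⊗ₜ v)) := by
      induction z using TensorProduct.induction_on with
      | zero => simp
      | add a b ha hb => simp only [map_add, LinearMap.add_apply, ha, hb]
      | tmul a b =>
        rw [evAct_tmul, psi_tmul, map_mul, map_mul, Module.End.mul_apply, Module.End.mul_apply,
          tact_tmul, map_one]
        exact (hom_apply f a _).symm
    refine (key (evElt k H)).trans ?_
    rw [psi_evElt, map_one]
    rfl
  curry_unique {X V W} f g h := by
    ext : 1
    apply LinearMap.ext
    intro x
    apply LinearMap.ext
    intro v
    have key (z : H ⊗[k] H) : evAct V.ρ W.ρ (evElt k H)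
        (TensorProduct.map g.lin LinearMap.id (tact X.ρ V.ρ z (x ⊗ₜ v))) =
        evAct V.ρ W.ρ (lam (S (k := k)) (α (k := k)) (φ.val *
          Algebra.TensorProduct.assoc k k k H H H
            (Algebra.TensorProduct.map Δ (AlgHom.id k H) z))) (g.lin x ⊗ₜ v) := by
      induction z using TensorProduct.induction_on with
      | zero => simp
      | add a b ha hb => simp only [map_add, mul_add, LinearMap.add_apply, ha, hb]
      | tmul a b =>
        rw [tact_tmul, TensorProduct.map_tmul, hom_apply g a x]
        exact evAct_lam (S (k := k)) (α (k := k)) V.ρ W.ρ φ.val (Δ a) b (g.lin x) v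
    have h1 := LinearMap.congr_fun (congrArg Hom.lin h) (tact X.ρ V.ρ (curryElt k H) (x ⊗ₜ v))
    have h2 := (key (curryElt k H)).symm.trans h1
    rw [lam_curryElt] at h2
    refine Eq.trans ?_ h2
    rw [Algebra.TensorProduct.one_def, evAct_tmul, map_one, map_one]
    rfl

end HRep


namespace HRep

variable {k : Type u} {H : Type w} [CommRing k] [Ring H] [Algebra k H]

/-- A submodule stable under the action, as a representation. -/
def sub (V : HRep k H) (p : Submodule k V) (hp : ∀ h, ∀ x ∈ p, V.ρ h x ∈ p) : HRep k H where
  carrier := p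
  ρ :=
    { toFun := fun h => (V.ρ h).restrict (hp h)
      map_one' := by ext; simp
      map_mul' := fun x y => by ext; simp
      map_zero' := by ext; simp
      map_add' := fun x y => by ext; simp
      commutes' := fun c => by ext; simp [Module.algebraMap_end_apply] }

/-- The quotient by a stable submodule. -/
def quot (V : HRep k H) (p : Submodule k V) (hp : ∀ h, ∀ x ∈ p, V.ρ h x ∈ p) : HRep k H where
  carrier := V ⧸ p
  ρ :=
    { toFun := fun h => p.mapQ p (V.ρ h) (fun x hx => hp h x hx)
      map_one' := by ext; simp
      map_mul' := fun x y => by ext; simp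
      map_zero' := by ext; simp
      map_add' := fun x y => by ext; simp
      commutes' := fun c => by ext; simp [Module.algebraMap_end_apply] }

theorem ker_stable {V W : HRep k H} (f g : V ⟶ W) (h : H) (x : V)
    (hx : x ∈ LinearMap.ker (f.lin - g.lin)) : V.ρ h x ∈ LinearMap.ker (f.lin - g.lin) := by
  rw [LinearMap.mem_ker, LinearMap.sub_apply, hom_apply, hom_apply, ← map_sub,
    ← LinearMap.sub_apply, LinearMap.mem_ker.1 hx, map_zero]

theorem range_stable {V W : HRep k H} (f g : V ⟶ W) (h : H) (x : W)
    (hx : x ∈ LinearMap.range (f.lin - g.lin)) : W.ρ h x ∈ LinearMap.range (f.lin - g.lin) := by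
  obtain ⟨v, rfl⟩ := hx
  exact ⟨V.ρ h v, by rw [LinearMap.sub_apply, hom_apply, hom_apply, ← map_sub]; rfl⟩

theorem fork_cond {V W U : HRep k H} {f g : V ⟶ W} {i : U ⟶ V} (w : i ≫ f = i ≫ g) (u : U) :
    i.lin u ∈ LinearMap.ker (f.lin - g.lin) := by
  have := LinearMap.congr_fun (congrArg Hom.lin w) u
  rw [LinearMap.mem_ker, LinearMap.sub_apply, sub_eq_zero]
  exact this

instance : HasEqualizers (HRep k H) := by
  refine @hasEqualizers_of_hasLimit_parallelPair _ _ ?_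
  intro V W f g
  let E := sub V (LinearMap.ker (f.lin - g.lin)) (ker_stable f g)
  let i : E ⟶ V := ⟨(LinearMap.ker (f.lin - g.lin)).subtype, fun h => rfl⟩
  have w : i ≫ f = i ≫ g := by
    ext x
    have h : (f.lin - g.lin) x.1 = 0 := x.2
    rw [LinearMap.sub_apply, sub_eq_zero] at h
    exact h
  exact ⟨⟨⟨Fork.ofι i w, Fork.IsLimit.mk _
    (fun s => (⟨s.ι.lin.codRestrict _ (fun u => fork_cond s.condition u), fun h => by
      apply LinearMap.ext
      intro u
      exact Subtype.ext (hom_apply s.ι h u)⟩ : s.pt ⟶ E))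
    (fun s => by ext; rfl)
    (fun s m hm => by
      ext u
      exact Subtype.ext (LinearMap.congr_fun (congrArg Hom.lin hm) u))⟩⟩⟩

instance : HasCoequalizers (HRep k H) := by
  refine @hasCoequalizers_of_hasColimit_parallelPair _ _ ?_
  intro V W f g
  let Q := quot W (LinearMap.range (f.lin - g.lin)) (range_stable f g)
  let q : W ⟶ Q := ⟨(LinearMap.range (f.lin - g.lin)).mkQ, fun h => rfl⟩
  have w : f ≫ q = g ≫ q := by
    ext x
    exact (Submodule.Quotient.eq _).2 ⟨x, rfl⟩
  exact ⟨⟨⟨Cofork.ofπ q w, Cofork.IsColimit.mk _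
    (fun s => (⟨(LinearMap.range (f.lin - g.lin)).liftQ s.π.lin (by
      rintro _ ⟨v, rfl⟩
      have h := LinearMap.congr_fun (congrArg Hom.lin s.condition) v
      rw [LinearMap.mem_ker, LinearMap.sub_apply, map_sub, sub_eq_zero]
      exact h), fun h => by
      apply LinearMap.ext
      intro u
      induction u using Submodule.Quotient.induction_on with
      | _ u => exact hom_apply s.π h u⟩ : Q ⟶ s.pt))
    (fun s => by ext; rfl)
    (fun s m hm => by
      ext u
      induction u using Submodule.Quotient.induction_on with
      | _ u => exact LinearMap.congr_fun (congrArg Hom.lin hm) u)⟩⟩⟩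

open QuasiBialgebra QuasiHopfAlgebra TAct in
theorem map_lin [QuasiHopfAlgebra k H] {V W X Y : HRep k H} (f : X ⟶ V) (g : W ⟶ Y)
    (L : V →ₗ[k] W) : (RightInternalHom.map f g).lin L = g.lin ∘ₗ L ∘ₗ f.lin := by
  have hact (D : H ⊗[k] H) (L : V →ₗ[k] W) :
      g.lin ∘ₗ homAct (S (k := k)) V.ρ W.ρ D L ∘ₗ f.lin =
        homAct (S (k := k)) X.ρ Y.ρ D (g.lin ∘ₗ L ∘ₗ f.lin) := by
    induction D using TensorProduct.induction_on with
    | zero => simp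
    | add a b ha hb =>
      simp only [map_add, LinearMap.add_apply, LinearMap.add_comp, LinearMap.comp_add, ha, hb]
    | tmul a b =>
      rw [homAct_tmul, homAct_tmul]
      ext x
      simp only [LinearMap.comp_apply, hom_apply]
  let m : homObj V W ⟶ homObj X Y :=
    ⟨(g.lin.compRight k).comp (LinearMap.lcomp k W f.lin), fun h => by
      apply LinearMap.ext
      intro L
      exact hact (Δ h) L⟩
  have hm : m = RightInternalHom.map f g := by
    apply RightInternalHom.curry_unique
    ext : 1
    apply TensorProduct.ext'
    intro L x
    have key (z : H ⊗[k] H) : evAct X.ρ Y.ρ z ((g.lin ∘ₗ L ∘ₗ f.lin) ⊗ₜ x) =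
        g.lin (evAct V.ρ W.ρ z (L ⊗ₜ f.lin x)) := by
      induction z using TensorProduct.induction_on with
      | zero => simp
      | add a b ha hb => simp only [map_add, LinearMap.add_apply, ha, hb]
      | tmul a b => simp only [evAct_tmul, LinearMap.comp_apply, hom_apply]
    exact key (evElt k H)
  rw [← hm]
  rfl

end HRep

/-! Both identities are coherence facts that hold in every braided monoidal category with internal
homs. The work specific to `H` and `A` lies in showing that symmetric bimodules form such a
category. For `HRep k H` the axioms on `φ` give the pentagon and triangle, those on `R` the
hexagons, and the antipode identities `psi_evElt` and `lam_curryElt` make evaluation and currying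
mutually inverse. Tensoring with an object is then a left adjoint, so it preserves the coequalizers
that define the tensor product over `A`. The symmetry conditions on bimodules let the braiding
descend to these quotients, and they pass to the tensor product and to `hom_A`. The instances on
`SymmBimod A` record the outcome, and what follows uses only that structure.

A morphism into an internal hom is determined by its uncurried form (`ihom_ext`), so each identity
may be tested after evaluating on a tensor product of modules. Evaluation removes every curried
morphism: composition becomes evaluation carried out twice (`comp_ev`), the functorial action
becomes pre- and postcomposition (`map_ev`), and the tensor product of homs becomes the exchange of
the two middle factors, `tensorμ`, followed by the two evaluations side by side (`tens_ev`). Since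
`tensorμ` is natural, all evaluations can be pushed to the end, where they agree on the two sides.
What remains is an equality between two ways of shuffling six factors by associators and braidings.

For (i), both shuffles carry `ihom X Z` past `ihom U V` and `U`, and carry `ihom W X` past `U`; they
differ only in the order of the crossings and in the bracketing. Their equality is
`tensor_associativity`, the associativity constraint that makes the tensor product a monoidal
functor of two variables with structure map `tensorμ`. For (ii), both shuffles carry `ihom Y Z` past
`U` and `W`, and carry `ihom W X` past `U`. Their equality is `associator_monoidal`, which says that
the associator is a monoidal transformation. In either case corresponding crossings have the same
sign on both sides, so the hexagons and naturality suffice and the braiding need not square to the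
identity.

In the language of enriched categories, (i) says that the tensor product respects composition of
internal homs, and (ii) that the associator is natural with respect to internal homs. -/

namespace RightInternalHom

/-! ### Evaluating composition, functorial action and tensor product of internal homs -/

variable {C : Type u₁} [Category.{v₁} C] [MonoidalCategory C] [RightInternalHom C]

/-- The computation rule that replaces the definition from here on: applying a composite means
applying the inner map and then the outer one, up to the associator. It is the currying law
`curry_ev` applied to the morphism whose curried form defines the composition. -/
theorem comp_ev (V W X : C) :
    RightInternalHom.comp V W X ▷ V ≫ ev V X =
      (α_ (ihom W X) (ihom V W) V).hom ≫ ihom W X ◁ ev V W ≫ ev W X :=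
  curry_ev _

/-- Again the currying law. It is needed only in the weak associativity, where conjugation by
associators compares internal homs between differently bracketed tensor products. -/
theorem map_ev {V W X Y : C} (f : X ⟶ V) (g : W ⟶ Y) :
    RightInternalHom.map f g ▷ X ≫ ev X Y = ihom V W ◁ f ≫ ev V W ≫ g :=
  curry_ev _

variable [BraidedCategory C]

/-- The five structural factors in the definition of the tensor product morphism, which rebracket
and braid the second hom past the first module, are exactly `tensorμ`. Naming them as one morphism
makes available its naturality in all four arguments and its coherence theorems, so no braiding or
associator has to be manipulated by hand later. -/
theorem tens_ev (V W X Y : C) :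
    tens V W X Y ▷ (V ⊗ X) ≫ ev (V ⊗ X) (W ⊗ Y) =
      tensorμ (ihom V W) (ihom X Y) V X ≫ (ev V W ⊗ₘ ev X Y) := by
  rw [tens, curry_ev]
  simp only [tensorμ, Category.assoc]

/-! ### Braided composition: the interchange of tensor product and composition -/

/-- The braided composition property of internal homs in a braided category. -/
theorem tens_comp_tens (U V W X Y Z : C) :
    (tens V Y X Z ⊗ₘ tens U V W X) ≫ RightInternalHom.comp (U ⊗ W) (V ⊗ X) (Y ⊗ Z) =
      tensorμ (ihom V Y) (ihom X Z) (ihom U V) (ihom W X) ≫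
        (RightInternalHom.comp U V Y ⊗ₘ RightInternalHom.comp W X Z) ≫ tens U Y W Z := by
  -- From here on both sides are compared as maps out of a tensor product of six factors: four homs,
  -- then `U` and `W`.
  apply ihom_ext
  -- Left side in normal form: all structural morphisms first, then one nested evaluation per tensor
  -- factor. The inner tensor product of homs acts on `U ⊗ W` before the outer one acts on the
  -- result, so the inner exchange precedes the outer one; pushing the inner evaluations through the
  -- latter enlarges its last two arguments to `ihom U V ⊗ U` and `ihom W X ⊗ W`.
  have hl : (tens V Y X Z ⊗ₘ tens U V W X) ▷ (U ⊗ W) ≫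
      RightInternalHom.comp (U ⊗ W) (V ⊗ X) (Y ⊗ Z) ▷ (U ⊗ W) ≫ ev (U ⊗ W) (Y ⊗ Z) =
      (α_ _ _ _).hom ≫ _ ◁ tensorμ (ihom U V) (ihom W X) U W ≫
        tensorμ (ihom V Y) (ihom X Z) _ _ ≫
        ((ihom V Y ◁ ev U V ≫ ev V Y) ⊗ₘ (ihom X Z ◁ ev W X ≫ ev X Z)) := by
    -- Whiskering by `U ⊗ W` is rewritten as tensoring with an identity so that naturality of the
    -- associator applies to all three factors. The variant `tensorHom_def'` is chosen because it
    -- lists the inner factor first; the exchange law then delays the outer tensor product of homs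
    -- until after the inner evaluation. Each copy of `tens` thereby stands directly before its own
    -- evaluation, where `tens_ev` can remove it. The last two rewrites move the inner evaluations
    -- past the outer exchange and merge them with the outer evaluations.
    rw [comp_ev, ← tensorHom_id, associator_naturality_assoc, tensorHom_id, tensorHom_def',
      Category.assoc, ← whisker_exchange_assoc, tens_ev, ← whiskerLeft_comp_assoc, tens_ev,
      whiskerLeft_comp, Category.assoc, tensorμ_natural_right_assoc, tensorHom_comp_tensorHom]
  -- Right side in the same normal form, with the same nested evaluations at the end. Here each
  -- composition sits inside one leg of the tensor product, so `comp_ev` is used once per leg, and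
  -- this produces a pair of associators. The exchange of homs prescribed by the statement is not
  -- included; it stays in front, whiskered by `U ⊗ W`.
  have hr : (RightInternalHom.comp U V Y ⊗ₘ RightInternalHom.comp W X Z) ▷ (U ⊗ W) ≫
      tens U Y W Z ▷ (U ⊗ W) ≫ ev (U ⊗ W) (Y ⊗ Z) =
      tensorμ _ _ _ _ ≫ ((α_ _ _ _).hom ⊗ₘ (α_ _ _ _).hom) ≫
        ((ihom V Y ◁ ev U V ≫ ev V Y) ⊗ₘ (ihom X Z ◁ ev W X ≫ ev X Z)) := by
    rw [tens_ev, tensorμ_natural_left_assoc, tensorHom_comp_tensorHom, comp_ev, comp_ev,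
      tensorHom_comp_tensorHom]
  simp only [comp_whiskerRight, Category.assoc]
  -- With the common nested evaluations split off, the goal is the associativity constraint of
  -- `tensorμ` for the three pairs `(ihom V Y, ihom X Z)`, `(ihom U V, ihom W X)` and `(U, W)`.
  rw [hl, hr, reassoc_of% tensor_associativity]

/-! ### Weak associativity: compatibility of the tensor product of homs with the associator -/

/-- The weak associativity of the tensor product of internal homs in a braided category. -/
theorem tens_tens (U V W X Y Z : C) :
    tens U V W X ▷ ihom Y Z ≫ tens (U ⊗ W) (V ⊗ X) Y Z ≫
        RightInternalHom.map (α_ U W Y).inv (α_ V X Z).hom =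
      (α_ (ihom U V) (ihom W X) (ihom Y Z)).hom ≫
        ihom U V ◁ tens W X Y Z ≫ tens U V (W ⊗ Y) (X ⊗ Z) := by
  -- The test object is `U ⊗ (W ⊗ Y)`, the source attained after conjugating by the associators. On
  -- the left side it must be rebracketed before the tensor products of homs can act.
  apply ihom_ext
  -- Left side, stated on the source `(U ⊗ W) ⊗ Y`, that is, with the inverse associator already
  -- removed. The outer exchange splits off `ihom Y Z` and `Y`; the inner one then acts on the first
  -- leg only. The final associator on the values is moved in front of the evaluations by
  -- naturality, so that the three evaluations end up bracketed to the right, as they are on the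
  -- other side.
  have hl : tens U V W X ▷ ihom Y Z ▷ ((U ⊗ W) ⊗ Y) ≫
      tensorμ (ihom (U ⊗ W) (V ⊗ X)) (ihom Y Z) (U ⊗ W) Y ≫
        (ev (U ⊗ W) (V ⊗ X) ⊗ₘ ev Y Z) ≫ (α_ V X Z).hom =
      tensorμ (ihom U V ⊗ ihom W X) (ihom Y Z) (U ⊗ W) Y ≫
        tensorμ (ihom U V) (ihom W X) U W ▷ (ihom Y Z ⊗ Y) ≫ (α_ _ _ _).hom ≫
          (ev U V ⊗ₘ (ev W X ⊗ₘ ev Y Z)) := by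
    -- Naturality of `tensorμ` in its first two arguments is stated for a tensor product of
    -- morphisms, hence the identity inserted on `ihom Y Z`; it is discarded again once the exchange
    -- has been passed.
    rw [← tensorHom_id (tens U V W X), tensorμ_natural_left_assoc,
      tensorHom_comp_tensorHom_assoc, tens_ev, id_whiskerRight, Category.id_comp,
      ← whiskerRight_comp_tensorHom_assoc, associator_naturality]
  -- Right side, the mirror image: the outer exchange splits off `ihom U V` and `U`, and the inner
  -- one acts on the second leg. No associator is needed, because source and values are already
  -- bracketed to the right.
  have hr : (ihom U V ◁ tens W X Y Z) ▷ (U ⊗ (W ⊗ Y)) ≫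
      tensorμ (ihom U V) (ihom (W ⊗ Y) (X ⊗ Z)) U (W ⊗ Y) ≫
        (ev U V ⊗ₘ ev (W ⊗ Y) (X ⊗ Z)) =
      tensorμ (ihom U V) (ihom W X ⊗ ihom Y Z) U (W ⊗ Y) ≫
        (ihom U V ⊗ U) ◁ tensorμ (ihom W X) (ihom Y Z) W Y ≫
          (ev U V ⊗ₘ (ev W X ⊗ₘ ev Y Z)) := by
    rw [← id_tensorHom _ (tens W X Y Z), tensorμ_natural_left_assoc, tensorHom_comp_tensorHom,
      tens_ev, id_whiskerRight, Category.id_comp, ← whiskerLeft_comp_tensorHom]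
  simp only [comp_whiskerRight, Category.assoc]
  -- `map_ev` leaves an inverse associator on the modules wedged between the tensor products of homs
  -- and the evaluation. It acts on other factors than those morphisms do, so two uses of the
  -- exchange law carry it to the front; the first also brings the outer `tens` next to its
  -- evaluation. Then `hl` applies, and `associator_monoidal` trades the left shuffle for the right
  -- one at the price of an associator on the homs tensored with an associator on the modules. In
  -- the order given by `tensorHom_def'` the module part comes first and cancels against the inverse
  -- associator; the hom part is the rebracketing that the right side of the identity asks for.
  rw [map_ev, tens_ev, hr, ← whisker_exchange_assoc, reassoc_of% tens_ev,
    ← whisker_exchange_assoc, hl, reassoc_of% associator_monoidal,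
    MonoidalCategory.tensorHom_def', Category.assoc, ← whiskerLeft_comp_assoc, Iso.inv_hom_id,
    whiskerLeft_id, Category.id_comp]

end RightInternalHom

/-- Every categorical symbol in the statement is resolved in `SymmBimod A`: the tensor products are
over `A`, and associators, braidings, internal homs and currying are the induced ones. Braided
commutativity of `A` is what makes the unit bimodule `A` symmetric, and so makes symmetric bimodules
a monoidal subcategory. Composites are written in diagrammatic order, so the factors of the flip `Θ`
appear in the reverse of the order used in the informal formula. -/
theorem mainTheorem10 {k : Type u} [CommRing k] {H : Type w} [Ring H] [Algebra k H]
    [QuasiHopfAlgebra k H] [Quasitriangular k H] (A : Mon (HRep k H)) [IsCommMonObj A.X] :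
    (∀ U V W X Y Z : SymmBimod A,
      (tens V Y X Z ⊗ₘ tens U V W X) ≫ RightInternalHom.comp (U ⊗ W) (V ⊗ X) (Y ⊗ Z) =
        (α_ (ihom V Y) (ihom X Z) (ihom U V ⊗ ihom W X)).hom ≫
          ihom V Y ◁ (α_ (ihom X Z) (ihom U V) (ihom W X)).inv ≫
          ihom V Y ◁ ((β_ (ihom X Z) (ihom U V)).hom ▷ ihom W X) ≫
          ihom V Y ◁ (α_ (ihom U V) (ihom X Z) (ihom W X)).hom ≫
          (α_ (ihom V Y) (ihom U V) (ihom X Z ⊗ ihom W X)).inv ≫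
          (RightInternalHom.comp U V Y ⊗ₘ RightInternalHom.comp W X Z) ≫ tens U Y W Z) ∧
    (∀ U V W X Y Z : SymmBimod A,
      tens U V W X ▷ ihom Y Z ≫ tens (U ⊗ W) (V ⊗ X) Y Z ≫
          RightInternalHom.map (α_ U W Y).inv (α_ V X Z).hom =
        (α_ (ihom U V) (ihom W X) (ihom Y Z)).hom ≫
          ihom U V ◁ tens W X Y Z ≫ tens U V (W ⊗ Y) (X ⊗ Z)) := by
  refine ⟨fun U V W X Y Z => ?_, fun U V W X Y Z => tens_tens U V W X Y Z⟩
  -- The flip `Θ` is `tensorμ` at the four hom objects; unfolding it turns the general identity into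
  -- the explicit one.
  simpa only [tensorμ, Category.assoc] using tens_comp_tens U V W X Y Z
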